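/- **Setting.** Let $d\ge 1$, let $\mathcal X\subseteq\mathbb R^d$ be convex and compact, let $\xi$ be a random variable with values in some measurable space, and let $f_\xi(x)=f(x;\xi)$ be real-valued losses with objective $f(x)=\mathbb E_\xi[f(x;\xi)]$. For $\beta>0$ and $u\in\mathbb R^d$ let $$\hat\nabla_{uni}f_\xi(x)=\frac{d\,(f_\xi(x+\beta u)-f_\xi(x))}{\beta}\,u ,$$ the uniform smoothing gradient estimator (UniGE), where $u$ is drawn uniformly from the unit sphere, independently of $\xi$; let $f_\beta(x)=\mathbb E[f(x+\beta u')]$ with $u'$ uniform over the unit ball. The Frank–Wolfe gap is $\mathcal G(x)=\max_{w\in\mathcal X}\langle w-x,-\nabla f(x)\rangle$. **Assumptions**, for constants $L,D,\sigma_2,\triangle\ge 0$ and the smoothing parameter $\beta$ in use: (1) there is an open set $U\supseteq\{x:\operatorname{dist}(x,\mathcal X)\le\beta\}$ such that $f(x;\xi)$ is integrable for every $x\in U$ and each loss $f_\xi$ is $L$-smooth on $U$, i.e. differentiable with $\|\nabla f_\xi(x)-\nabla f_\xi(y)\|\le L\|x-y\|$ for $x,y\in U$; (2) $\mathbb E\|\hat\nabla_{uni}f_\xi(x)-\nabla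 f_\beta(x)\|^2\le\sigma_2^2$ for all $x\in\mathcal X$; (3) $\|x-y\|\le D$ for all $x,y\in\mathcal X$; (4) $f(x)-\inf_{y\in\mathcal X}f(y)\le\triangle$ for all $x\in\mathcal X$. **Algorithm** (Acc-SZOFW* with UniGE), for $T\ge 2$ iterations. Start from $x_0=y_0=z_0\in\mathcal X$. For $t=0,\dots,T-1$: draw one sample $\xi_t$ and one direction $u_t$ (uniform over the unit sphere), independent of each other and of everything before; let $v_0=\hat\nabla_{uni}f_{\xi_0}(z_0)$ and, for $t\ge1$, $$v_t=\hat\nabla_{uni}f_{\xi_t}(z_t)+(1-\rho_t)\big(v_{t-1}-\hat\nabla_{uni}f_{\xi_t}(z_{t-1})\big)$$ (both estimators use $\xi_t$ and $u_t$); choose $w_t\in\arg\max_{w\in\mathcal X}\langle w,-v_t\rangle$; set $x_{t+1}=x_t+\gamma_t(w_t-x_t)$, $y_{t+1}=z_t+\eta_t(w_t-z_t)$, $z_{t+1}=(1-\alpha_{t+1})y_{t+1}+\alpha_{t+1}x_{t+1}$. The parameters are $\alpha_t=\frac1{t+1}$, $\theta_t=\frac1{(t+1)(t+2)}$, $\eta_t=T^{-2/3}$,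 $\gamma_t=(1+\theta_t)\eta_t$, $\rho_t=t^{-2/3}$ for $t\ge1$, and $\beta=d^{-1}T^{-2/3}$. The output is $z_\zeta$ with $\zeta$ uniform over $\{0,\dots,T-1\}$ and independent of the rest. **Theorem 5.** There are constants $C_1,C_2,K,M$ depending only on $L,D,\sigma_2,\triangle$ (not on $d$, $T$, $\varepsilon$, the problem or the run) such that the following holds. (a) For all $d\ge1$, $T\ge2$, all problems satisfying the assumptions and all runs of the algorithm, the expectations below exist and $$\mathbb E[\mathcal G(z_\zeta)]=\frac1T\sum_{t=0}^{T-1}\mathbb E[\mathcal G(z_t)]\le C_1\frac{\sqrt d}{T^{1/3}}+C_2\frac{\sqrt d\,\ln T}{T^{4/3}} .$$ (b) For all $d\ge1$ and $0<\varepsilon\le1$, the choice $T=\lceil K d^{3/2}\varepsilon^{-3}\rceil$ satisfies $T\ge2$, and every run with this $T$ (on a problem satisfying the assumptions) has $\mathbb E[\mathcal G(z_\zeta)]\le\varepsilon$ and makes in total at most $M d^{3/2}\varepsilon^{-3}$ queries of function values $f(\cdot\,;\xi_t)$. -/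

import Mathlib

open MeasureTheory ProbabilityTheory

noncomputable section

namespace ZerothOrderFW

/-- The Euclidean space `ℝ^d`. -/
abbrev E (d : ℕ) : Type := EuclideanSpace ℝ (Fin d)

/-! ### Programs with function-value queries, and their cost -/

/-- A program that returns an `α` and whose only access to a real-valued function on `Q` is to
ask for its value at points of `Q`. -/
inductive QueryProg (Q α : Type) : Type
  | ret (a : α) : QueryProg Q α
  | ask (q : Q) (k : ℝ → QueryProg Q α) : QueryProg Q α

namespace QueryProg

variable {Q α γ : Type}

/-- Sequential composition. -/
def bind : QueryProg Q α → (α → QueryProg Q γ) → QueryProg Q γ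
  | ret a, h => h a
  | ask q k, h => ask q (fun r => (k r).bind h)

/-- The value returned when the queries are answered by `g`. -/
def result (g : Q → ℝ) : QueryProg Q α → α
  | ret a => a
  | ask q k => (k (g q)).result g

/-- The number of function queries made when they are answered by `g`. -/
def cost (g : Q → ℝ) : QueryProg Q α → ℕ
  | ret _ => 0
  | ask q k => (k (g q)).cost g + 1

end QueryProg

/-! ### The uniform smoothing gradient estimator -/

/-- The uniform distribution over the unit sphere of `ℝ^d` (for `1 ≤ d`): the normalized
surface measure. -/
def uniformSphere (d : ℕ) : Measure (Metric.sphere (0 : E d) 1) :=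
  ((volume : Measure (E d)).toSphere Set.univ)⁻¹ • (volume : Measure (E d)).toSphere

/-- `(d (g(x + β u) - g(x)) / β) u`. -/
def uniGE {d : ℕ} (β : ℝ) (g : E d → ℝ) (u x : E d) : E d :=
  ((d : ℝ) * (g (x + β • u) - g x) / β) • u

/-- The program that computes the estimator from two function values. -/
def uniGEProg {d : ℕ} (β : ℝ) (u x : E d) : QueryProg (E d) (E d) :=
  .ask (x + β • u) fun a => .ask x fun b => .ret (((d : ℝ) * (a - b) / β) • u)

theorem uniGEProg_result {d : ℕ} (β : ℝ) (g : E d → ℝ) (u x : E d) :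
    (uniGEProg β u x).result g = uniGE β g u x := rfl

/-! ### The problem -/

/-- `f(x) = 𝔼_ξ[F(x; ξ)]`, with `ξ` distributed according to `μ`. -/
def objective {d : ℕ} {S : Type*} [MeasurableSpace S] (μ : Measure S) (F : E d → S → ℝ)
    (x : E d) : ℝ :=
  ∫ s, F x s ∂μ

/-- `f_β(x) = 𝔼[f(x + β u)]`, with `u` uniform over the unit ball. -/
def ballSmoothing {d : ℕ} (β : ℝ) (f : E d → ℝ) (x : E d) : ℝ :=
  ⨍ u in Metric.closedBall (0 : E d) 1, f (x + β • u)

/-- The Frank–Wolfe gap `max_{w ∈ X} ⟨w - x, -∇f(x)⟩`. -/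
def fwGap {d : ℕ} (X : Set (E d)) (f : E d → ℝ) (x : E d) : ℝ :=
  sSup ((fun w => inner ℝ (w - x) (-gradient f x)) '' X)

/-- `g` is differentiable on `U` with `L`-Lipschitz gradient. -/
def LSmoothOn {d : ℕ} (L : ℝ) (g : E d → ℝ) (U : Set (E d)) : Prop :=
  (∀ x ∈ U, DifferentiableAt ℝ g x) ∧
    ∀ x ∈ U, ∀ y ∈ U, ‖gradient g x - gradient g y‖ ≤ L * ‖x - y‖

/-- The standing assumptions on the problem `min_{x ∈ X} 𝔼_ξ[F(x; ξ)]`, where `β` is the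
smoothing parameter of the gradient estimator. -/
structure Assumptions {d : ℕ} {S : Type*} [MeasurableSpace S] (μ : Measure S)
    (F : E d → S → ℝ) (X : Set (E d)) (β L D σ Δ : ℝ) : Prop where
  measurable : Measurable (Function.uncurry F)
  convex : Convex ℝ X
  compact : IsCompact X
  diam : ∀ x ∈ X, ∀ y ∈ X, ‖x - y‖ ≤ D
  /-- Every loss is `L`-smooth (and the expectation exists) on an open set that contains all points
  at distance at most `β` from `X`, that is, all points where function values are queried. -/
  smooth : ∃ U : Set (E d), IsOpen U ∧ Metric.cthickening β X ⊆ U ∧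
    (∀ x ∈ U, Integrable (F x) μ) ∧ ∀ s, LSmoothOn L (fun x => F x s) U
  /-- The variance of the stochastic zeroth-order gradient is at most `σ²`. -/
  variance : ∀ x ∈ X,
    ∫⁻ p, ‖uniGE β (fun y => F y p.1) (p.2 : E d) x
      - gradient (ballSmoothing β (objective μ F)) x‖ₑ ^ 2 ∂(μ.prod (uniformSphere d))
      ≤ ENNReal.ofReal (σ ^ 2)
  bounded : ∀ x ∈ X, objective μ F x - sInf (objective μ F '' X) ≤ Δ

/-! ### The algorithm -/

/-- The program computing `v_t` from the current direction `u = u_t`, the points `z_0, …, z_t` and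
`v_0, …, v_{t-1}`; its queries are answered by `F(·; ξ_t)`. -/
def gradStep {d : ℕ} (β : ℝ) (ρ : ℕ → ℝ) (u : E d) (z v : ℕ → E d) : ℕ → QueryProg (E d) (E d)
  | 0 => uniGEProg β u (z 0)
  | t + 1 =>
    (uniGEProg β u (z (t + 1))).bind fun g =>
      (uniGEProg β u (z t)).bind fun g' =>
        .ret (g + (1 - ρ (t + 1)) • (v t - g'))

/-- The random processes `ξ, u, v, w, x, y, z` are a run of `T` iterations of Acc-SZOFW* with the
uniform smoothing gradient estimator, with step sizes `η, γ`, weights `α, ρ` and smoothing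
parameter `β`, and `ζ` is the random index of the output `z_ζ`. `ℱ t` is the information available
at the end of iteration `t`. -/
structure IsRun {d : ℕ} {S Ω : Type*} [MeasurableSpace S] [MeasurableSpace Ω]
    (μ : Measure S) (F : E d → S → ℝ) (X : Set (E d))
    (T : ℕ) (η γ α ρ : ℕ → ℝ) (β : ℝ)
    (P : Measure Ω) (ℱ : Filtration ℕ (inferInstance : MeasurableSpace Ω))
    (ξ : ℕ → Ω → S) (u : ℕ → Ω → Metric.sphere (0 : E d) 1)
    (v w x y z : ℕ → Ω → E d) (ζ : Ω → ℕ) : Prop where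
  /-- In iteration `t`, one sample `ξ_t` and one direction `u_t` are drawn, independently of each
  other and of all that happened before. -/
  sample_measurable : ∀ t < T, Measurable[ℱ t] (fun ω => (ξ t ω, u t ω))
  sample_law : ∀ t < T, P.map (fun ω => (ξ t ω, u t ω)) = μ.prod (uniformSphere d)
  sample_indep : ∀ t, t + 1 < T →
    Indep (MeasurableSpace.comap (fun ω => (ξ (t + 1) ω, u (t + 1) ω)) inferInstance) (ℱ t) P
  /-- `x_0 = y_0 = z_0 ∈ X`. -/
  init : ∃ x₀ ∈ X, ∀ ω, x 0 ω = x₀ ∧ y 0 ω = x₀ ∧ z 0 ω = x₀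
  grad : ∀ t < T, ∀ ω, v t ω =
    (gradStep β ρ (u t ω : E d) (fun i => z i ω) (fun i => v i ω) t).result (fun q => F q (ξ t ω))
  /-- `w_t` maximizes `⟨w, -v_t⟩` over `X`; ties are broken without looking at later samples. -/
  argmax_measurable : ∀ t < T, Measurable[ℱ t] (w t)
  argmax_mem : ∀ t < T, ∀ ω, w t ω ∈ X
  argmax : ∀ t < T, ∀ ω, IsMaxOn (fun q => inner ℝ q (-v t ω)) X (w t ω)
  step_x : ∀ t < T, ∀ ω, x (t + 1) ω = x t ω + γ t • (w t ω - x t ω)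
  step_y : ∀ t < T, ∀ ω, y (t + 1) ω = z t ω + η t • (w t ω - z t ω)
  step_z : ∀ t < T, ∀ ω,
    z (t + 1) ω = (1 - α (t + 1)) • y (t + 1) ω + α (t + 1) • x (t + 1) ω
  /-- `ζ` is uniform over `{0, …, T - 1}` and independent of the iterations. -/
  index_measurable : Measurable ζ
  index_uniform : ∀ t < T, P {ω | ζ ω = t} = (T : ENNReal)⁻¹
  index_indep : Indep (MeasurableSpace.comap ζ inferInstance) (ℱ (T - 1)) P

/-- The number of function queries made in the `T` iterations. -/
def queries {d : ℕ} {S Ω : Type*} (F : E d → S → ℝ) (T : ℕ) (ρ : ℕ → ℝ) (β : ℝ)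
    (ξ : ℕ → Ω → S) (u : ℕ → Ω → Metric.sphere (0 : E d) 1) (v z : ℕ → Ω → E d) (ω : Ω) : ℕ :=
  ∑ t ∈ Finset.range T,
    (gradStep β ρ (u t ω : E d) (fun i => z i ω) (fun i => v i ω) t).cost (fun q => F q (ξ t ω))

/-! ### The parameters -/

/-- `α_t = 1 / (t + 1)`. -/
def parα (t : ℕ) : ℝ := 1 / ((t : ℝ) + 1)

/-- `θ_t = 1 / ((t + 1) (t + 2))`. -/
def parθ (t : ℕ) : ℝ := 1 / (((t : ℝ) + 1) * ((t : ℝ) + 2))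

/-- `η_t = T^{-2/3}`. -/
def parη (T : ℕ) (_t : ℕ) : ℝ := (T : ℝ) ^ (-(2 / 3) : ℝ)

/-- `γ_t = (1 + θ_t) η_t`. -/
def parγ (T : ℕ) (t : ℕ) : ℝ := (1 + parθ t) * parη T t

/-- `ρ_t = t^{-2/3}`, used for `t ≥ 1` only. -/
def parρ (t : ℕ) : ℝ := (t : ℝ) ^ (-(2 / 3) : ℝ)

/-- `β = d⁻¹ T^{-2/3}`. -/
def parβ (d T : ℕ) : ℝ := (d : ℝ)⁻¹ * (T : ℝ) ^ (-(2 / 3) : ℝ)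

end ZerothOrderFW

end

/-! The proof combines a deterministic descent estimate along each trajectory with a second-moment
recursion for the gradient estimates.

Descent (`IsFWPath.mul_fwGap_le`). By `IsFWPath.sub_succ`, z moves by a Frank–Wolfe step of length
about η plus a drift c_t (x_t - y_t) with 0 ≤ c_t ≤ α_{t+1}, and `IsFWPath.seminorm_sub_le` keeps
x_t - y_t of order η. Since w_t is optimal for v_t, η 𝒢(z_t) is at most f(z_t) - f(z_{t+1}) + O(η
‖v_t - ∇f(z_t)‖ + η α_{t+1} + η²). Summing and dividing by η = T^{-2/3} leaves O(T^{2/3}) plus the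
sum of the gradient errors. No bound on ‖∇f‖ is available; pairings of ∇f with differences of points
of X are bounded through L, D and Δ instead.

Gradient error (`IsRun.lintegral_error_le`). The estimator is unbiased for ∇f_β by the divergence
theorem on the ball (`Assumptions.integral_estimator`). Two estimators sharing a sample differ in
mean square by O(d ‖y - x‖² + (dβ)²), because the uniform law on the sphere is isotropic
(`Assumptions.lintegral_estimator_sub_le`). With e_t = 𝔼‖v_t - ∇f_β(z_t)‖² this yields e_{t+1} ≤ (1
- ρ_{t+1})² e_t + B ρ_{t+1}² with B = O(d), solved by e_t ≤ 3B (t+1)^{-2/3}. The errors then sum to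
O(√d T^{2/3}), and the bias Lβ of ∇f_β is of lower order.

Division by T gives a bound R √d / T^{1/3} without any logarithm. The complexity claim follows by
solving for T, at no more than four queries per iteration. -/

noncomputable section

namespace ZerothOrderFW

/-! ### The divergence theorem on the unit ball. -/

section Divergence

open Set Metric Filter Topology

/-- Integration in polar coordinates. -/
theorem integral_polar {V : Type*} [NormedAddCommGroup V] [InnerProductSpace ℝ V]
    [FiniteDimensional ℝ V] [MeasurableSpace V] [BorelSpace V] [Nontrivial V]
    (μ : Measure V) [μ.IsAddHaarMeasure]
    {f : V → ℝ} (hf : Integrable f μ) :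
    ∫ x, f x ∂μ = ∫ r in Ioi (0 : ℝ), r ^ (Module.finrank ℝ V - 1) *
      ∫ u : sphere (0 : V) 1, f (r • (u : V)) ∂μ.toSphere := by
  have hmp := μ.measurePreserving_homeomorphUnitSphereProd
  have hemb := (homeomorphUnitSphereProd V).measurableEmbedding
  set g : sphere (0 : V) 1 × Ioi (0 : ℝ) → ℝ := fun p => f ((p.2 : ℝ) • (p.1 : V)) with hg
  have hcomp : ∀ x : ({0}ᶜ : Set V), g (homeomorphUnitSphereProd V x) = f x := by
    intro x
    have := (homeomorphUnitSphereProd V).symm_apply_apply x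
    have h2 := congrArg (Subtype.val) this
    rw [homeomorphUnitSphereProd_symm_apply_coe] at h2
    simp only [hg, h2]
  have hint : Integrable g (μ.toSphere.prod (.volumeIoiPow (Module.finrank ℝ V - 1))) := by
    rw [← hmp.integrable_comp_emb hemb]
    have : g ∘ homeomorphUnitSphereProd V = f ∘ Subtype.val := by
      ext x; exact hcomp x
    rw [this, ← integrableOn_iff_comap_subtypeVal (measurableSet_singleton _).compl]
    exact hf.integrableOn
  calc
    ∫ x, f x ∂μ = ∫ x : ({(0)}ᶜ : Set V), f x.1 ∂(μ.comap (↑)) := by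
      rw [integral_subtype_comap (measurableSet_singleton _).compl fun x ↦ f x,
        restrict_compl_singleton]
    _ = ∫ p, g p ∂μ.toSphere.prod (.volumeIoiPow (Module.finrank ℝ V - 1)) := by
      rw [← hmp.integral_comp hemb]
      simp only [hcomp]
    _ = ∫ r : Ioi (0 : ℝ), ∫ u, g (u, r) ∂μ.toSphere
          ∂.volumeIoiPow (Module.finrank ℝ V - 1) := integral_prod_symm _ hint
    _ = _ := by
      simp only [Measure.volumeIoiPow, ENNReal.ofReal, hg]
      rw [integral_withDensity_eq_integral_smul,
        integral_subtype_comap measurableSet_Ioi fun a ↦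
          Real.toNNReal (a ^ (Module.finrank ℝ V - 1)) •
            ∫ u : sphere (0 : V) 1, f (a • (u : V)) ∂μ.toSphere,
        setIntegral_congr_fun measurableSet_Ioi fun x hx ↦ ?_]
      · rw [NNReal.smul_def, Real.coe_toNNReal _ (pow_nonneg hx.out.le _), smul_eq_mul]
      · exact (measurable_subtype_coe.pow_const _).real_toNNReal

/-- The radial cutoff functions `x ↦ σ(n (1 - ‖x‖²))`. -/
def radialCutoff {V : Type*} [NormedAddCommGroup V] (n : ℕ) (x : V) : ℝ :=
  Real.smoothTransition (n * (1 - ‖x‖ ^ 2))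

theorem hasFDerivAt_radialCutoff {V : Type*} [NormedAddCommGroup V] [InnerProductSpace ℝ V]
    (n : ℕ) (x : V) :
    HasFDerivAt (radialCutoff n)
      (-(2 * n * deriv Real.smoothTransition (n * (1 - ‖x‖ ^ 2))) • innerSL ℝ x) x := by
  have h1 : HasFDerivAt (fun y : V => (n : ℝ) * (1 - ‖y‖ ^ 2))
      ((n : ℝ) • (-((2 : ℕ) • innerSL ℝ x : V →L[ℝ] ℝ))) x := by
    have := (hasStrictFDerivAt_norm_sq x).hasFDerivAt
    exact ((this.const_sub 1).const_mul (n : ℝ))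
  have h2 : HasDerivAt Real.smoothTransition
      (deriv Real.smoothTransition (n * (1 - ‖x‖ ^ 2))) (n * (1 - ‖x‖ ^ 2)) :=
    ((Real.smoothTransition.contDiff (n := 1)).differentiable (by norm_num) _).hasDerivAt
  have := h2.comp_hasFDerivAt x h1
  refine this.congr_fderiv ?_
  ext v
  simp
  ring

theorem continuous_deriv_smoothTransition : Continuous (deriv Real.smoothTransition) :=
  (Real.smoothTransition.contDiff (n := 1)).continuous_deriv (by norm_num)

theorem deriv_smoothTransition_nonneg (t : ℝ) : 0 ≤ deriv Real.smoothTransition t :=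
  Real.smoothTransition.monotone.deriv_nonneg

theorem deriv_smoothTransition_of_nonpos {t : ℝ} (ht : t ≤ 0) :
    deriv Real.smoothTransition t = 0 := by
  refine IsLocalMin.deriv_eq_zero (Filter.Eventually.of_forall fun y => ?_)
  rw [Real.smoothTransition.zero_of_nonpos ht]
  exact Real.smoothTransition.nonneg y

theorem deriv_smoothTransition_of_one_le {t : ℝ} (ht : 1 ≤ t) :
    deriv Real.smoothTransition t = 0 := by
  refine IsLocalMax.deriv_eq_zero (Filter.Eventually.of_forall fun y => ?_)
  rw [Real.smoothTransition.one_of_one_le ht]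
  exact Real.smoothTransition.le_one y

/-- The radial peak functions `-d/dr σ(n (1 - r²))`. -/
def radialPeak (n : ℕ) (r : ℝ) : ℝ :=
  2 * n * r * deriv Real.smoothTransition (n * (1 - r ^ 2))

theorem continuous_radialPeak (n : ℕ) : Continuous (radialPeak n) := by
  have := continuous_deriv_smoothTransition
  unfold radialPeak
  fun_prop

/-- The integrand is minus the derivative of r ↦ σ(n (1 - r²)), which falls from σ(n) = 1 to σ(0) =
0; n ≥ 1 ensures the first value. -/
theorem integral_radialPeak {n : ℕ} (hn : 1 ≤ n) : ∫ r in Icc (0 : ℝ) 1, radialPeak n r = 1 := by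
  rw [integral_Icc_eq_integral_Ioc, ← intervalIntegral.integral_of_le zero_le_one]
  have hd : ∀ r ∈ uIcc (0 : ℝ) 1,
      HasDerivAt (fun r => -Real.smoothTransition (n * (1 - r ^ 2))) (radialPeak n r) r := by
    intro r _
    have h1 : HasDerivAt (fun r : ℝ => (n : ℝ) * (1 - r ^ 2)) (n * (-(2 * r))) r := by
      have := (((hasDerivAt_id r).pow 2).const_sub 1).const_mul (n : ℝ)
      simpa using this
    have h2 : HasDerivAt Real.smoothTransition
        (deriv Real.smoothTransition (n * (1 - r ^ 2))) (n * (1 - r ^ 2)) :=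
      ((Real.smoothTransition.contDiff (n := 1)).differentiable (by norm_num) _).hasDerivAt
    have := (h2.comp r h1).neg
    refine this.congr_deriv ?_
    simp only [radialPeak]; ring
  rw [intervalIntegral.integral_eq_sub_of_hasDerivAt hd
    ((continuous_radialPeak n).intervalIntegrable _ _)]
  have : (1 : ℝ) ≤ n := by exact_mod_cast hn
  simp [Real.smoothTransition.one_of_one_le this]

/-- The peaks are nonnegative with unit mass on [0, 1] and vanish on [0, 1 - δ] once nδ ≥ 1, so they
approximate the Dirac mass at the endpoint 1. -/
theorem tendsto_integral_radialPeak {Q : ℝ → ℝ} (hQ : ContinuousOn Q (Icc 0 1)) :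
    Tendsto (fun n : ℕ => ∫ r in Icc (0 : ℝ) 1, radialPeak n r • Q r) atTop (𝓝 (Q 1)) := by
  refine tendsto_setIntegral_peak_smul_of_integrableOn_of_tendsto (x₀ := 1) measurableSet_Icc
    measurableSet_Icc subset_rfl self_mem_nhdsWithin (by simp) ?_ ?_ ?_ ?_
    hQ.integrableOn_Icc (hQ 1 (by simp))
  · refine Eventually.of_forall fun n x hx => ?_
    have := deriv_smoothTransition_nonneg (n * (1 - x ^ 2))
    have := hx.1
    unfold radialPeak
    positivity
  · intro s hs h1
    obtain ⟨δ, hδ, hball⟩ := Metric.isOpen_iff.1 hs 1 h1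
    obtain ⟨N, hN⟩ := exists_nat_gt (1 / δ)
    refine Metric.tendstoUniformlyOn_iff.2 fun ε hε => ?_
    filter_upwards [eventually_ge_atTop N] with n hn x hx
    have hx1 : x ≤ 1 - δ := by
      by_contra hcon
      push Not at hcon
      refine hx.2 (hball ?_)
      rw [mem_ball, Real.dist_eq, abs_lt]
      constructor <;> linarith [hx.1.2]
    have hx0 := hx.1.1
    have hnN : (N : ℝ) ≤ n := by exact_mod_cast hn
    have h2 : 1 ≤ (n : ℝ) * (1 - x ^ 2) := by
      have h3 : δ ≤ 1 - x ^ 2 := by nlinarith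
      have h4 : 1 ≤ (n : ℝ) * δ := by
        have := (div_lt_iff₀ hδ).1 (hN.trans_le hnN)
        linarith
      have : (0 : ℝ) ≤ n := by positivity
      nlinarith
    simp [radialPeak, deriv_smoothTransition_of_one_le h2, hε]
  · refine tendsto_const_nhds.congr' ?_
    filter_upwards [eventually_ge_atTop 1] with n hn
    exact (integral_radialPeak hn).symm
  · exact Eventually.of_forall fun n => (continuous_radialPeak n).aestronglyMeasurable

theorem radialCutoff_of_one_le {V : Type*} [NormedAddCommGroup V] {n : ℕ} {x : V}
    (hx : 1 ≤ ‖x‖) : radialCutoff n x = 0 := by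
  refine Real.smoothTransition.zero_of_nonpos ?_
  have : 1 - ‖x‖ ^ 2 ≤ 0 := by nlinarith
  exact mul_nonpos_of_nonneg_of_nonpos (by positivity) this

theorem continuous_radialCutoff {V : Type*} [NormedAddCommGroup V] (n : ℕ) :
    Continuous (radialCutoff n : V → ℝ) := by
  have := Real.smoothTransition.continuous
  unfold radialCutoff
  fun_prop

theorem tsupport_radialCutoff_subset {V : Type*} [NormedAddCommGroup V] (n : ℕ) :
    tsupport (radialCutoff n : V → ℝ) ⊆ closedBall 0 1 := by
  refine closure_minimal (fun x hx => ?_) isClosed_closedBall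
  by_contra hcon
  rw [mem_closedBall_zero_iff, not_le] at hcon
  exact hx (radialCutoff_of_one_le hcon.le)

/-- A function continuous on the closed unit ball, times a continuous function vanishing off the
ball, is integrable. -/
theorem integrable_mul_of_continuousOn_closedBall {V : Type*} [NormedAddCommGroup V]
    [InnerProductSpace ℝ V]
    [FiniteDimensional ℝ V] [MeasurableSpace V] [BorelSpace V] (μ : Measure V) [μ.IsAddHaarMeasure]
    {a b : V → ℝ} (ha : Continuous a)
    (ha0 : ∀ x, 1 ≤ ‖x‖ → a x = 0) (hb : ContinuousOn b (closedBall 0 1)) :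
    Integrable (fun x => a x * b x) μ := by
  have h1 : IntegrableOn (fun x => a x * b x) (closedBall 0 1) μ :=
    (ha.continuousOn.mul hb).integrableOn_compact (isCompact_closedBall _ _)
  refine (integrableOn_iff_integrable_of_support_subset ?_).1 h1
  intro x hx
  by_contra hcon
  rw [mem_closedBall_zero_iff, not_le] at hcon
  exact hx (by simp [ha0 x hcon.le])

/-- **Divergence theorem on the unit ball**, tested against a constant vector. -/
theorem setIntegral_closedBall_fderiv {V : Type*} [NormedAddCommGroup V] [InnerProductSpace ℝ V]
    [FiniteDimensional ℝ V] [MeasurableSpace V] [BorelSpace V] [Nontrivial V]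
    (μ : Measure V) [μ.IsAddHaarMeasure]
    {h : V → ℝ}
    (hd : ∀ x ∈ closedBall (0 : V) 1, DifferentiableAt ℝ h x) (e : V)
    (hc : ContinuousOn (fun x => fderiv ℝ h x e) (closedBall 0 1)) :
    ∫ x in closedBall (0 : V) 1, fderiv ℝ h x e ∂μ =
      ∫ u : sphere (0 : V) 1, h u * inner ℝ (u : V) e ∂μ.toSphere := by
  have hh : ContinuousOn h (closedBall 0 1) :=
    fun x hx => (hd x hx).continuousAt.continuousWithinAt
  -- `Q r` is the flux of `h • e` through the sphere of radius r. The limit of the integrals of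
  -- `radialCutoff n` times the derivative of `h` along `e` is computed twice: integration by parts
  -- and polar coordinates give `Q 1`, dominated convergence gives the integral over the open ball.
  set Q : ℝ → ℝ := fun r => r ^ (Module.finrank ℝ V - 1) *
      ∫ u : sphere (0 : V) 1, h (r • (u : V)) * inner ℝ (u : V) e ∂μ.toSphere with hQdef
  have hmaps : ∀ r ∈ Icc (0 : ℝ) 1, ∀ u : sphere (0 : V) 1, r • (u : V) ∈ closedBall (0 : V) 1 := by
    intro r hr u
    rw [mem_closedBall_zero_iff, norm_smul, norm_eq_of_mem_sphere, mul_one, Real.norm_eq_abs,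
      abs_of_nonneg hr.1]
    exact hr.2
  have hQ : ContinuousOn Q (Icc 0 1) := by
    refine (continuous_pow _).continuousOn.mul ?_
    obtain ⟨C, hC⟩ := (isCompact_closedBall (0 : V) 1).exists_bound_of_continuousOn hh
    refine continuousOn_of_dominated (bound := fun _ => C * ‖e‖) ?_ ?_ (integrable_const _) ?_
    · intro r hr
      refine Continuous.aestronglyMeasurable ?_
      refine Continuous.mul ?_ (by fun_prop)
      exact hh.comp_continuous (by fun_prop) (hmaps r hr)
    · intro r hr
      refine Eventually.of_forall fun u => ?_
      rw [norm_mul]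
      have h1 := hC _ (hmaps r hr u)
      have h2 : ‖inner ℝ (u : V) e‖ ≤ ‖e‖ := by
        simpa using norm_inner_le_norm (𝕜 := ℝ) (u : V) e
      exact mul_le_mul h1 h2 (norm_nonneg _) ((norm_nonneg _).trans h1)
    · refine Eventually.of_forall fun u => ?_
      refine ContinuousOn.mul ?_ continuousOn_const
      exact hh.comp (by fun_prop) (fun r hr => hmaps r hr u)
  have hQ1 : Q 1 = ∫ u : sphere (0 : V) 1, h u * inner ℝ (u : V) e ∂μ.toSphere := by
    simp [hQdef]
  -- Minus the derivative of `radialCutoff n` along `e`; at the point r u it equals `radialPeak n r`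
  -- times ⟨u, e⟩.
  set w : ℕ → V → ℝ := fun n x =>
    2 * n * deriv Real.smoothTransition (n * (1 - ‖x‖ ^ 2)) * inner ℝ x e with hw
  have hwc : ∀ n, Continuous (w n) := by
    intro n
    have := continuous_deriv_smoothTransition
    fun_prop
  have hw0 : ∀ n x, 1 ≤ ‖x‖ → w n x = 0 := by
    intro n x hx
    have : (n : ℝ) * (1 - ‖x‖ ^ 2) ≤ 0 :=
      mul_nonpos_of_nonneg_of_nonpos (by positivity) (by nlinarith)
    simp [hw, deriv_smoothTransition_of_nonpos this]
  have hint_w : ∀ n, Integrable (fun x => w n x * h x) μ := fun n =>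
    integrable_mul_of_continuousOn_closedBall μ (hwc n) (hw0 n) hh
  have hparts : ∀ n : ℕ, ∫ x, radialCutoff n x * fderiv ℝ h x e ∂μ = ∫ x, w n x * h x ∂μ := by
    intro n
    have hneg : ∀ x : V, (-(2 * n * deriv Real.smoothTransition (n * (1 - ‖x‖ ^ 2))) •
        innerSL ℝ x) e = -w n x := by
      intro x
      simp [hw]
    have := integral_bilinear_hasFDerivAt_right_eq_neg_left_of_integrable (μ := μ) (v := e)
      (f := radialCutoff n) (g := h) (g' := fderiv ℝ h)
      (f' := fun x => -(2 * n * deriv Real.smoothTransition (n * (1 - ‖x‖ ^ 2))) • innerSL ℝ x)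
      (B := ContinuousLinearMap.mul ℝ ℝ) ?_ ?_ ?_
      (fun x _ => hasFDerivAt_radialCutoff n x)
      (fun x hx => (hd x (tsupport_radialCutoff_subset n hx)).hasFDerivAt)
    · simp only [hneg, ContinuousLinearMap.mul_apply'] at this
      rw [this, ← integral_neg]
      simp
    · simp only [hneg, ContinuousLinearMap.mul_apply']
      simpa using (hint_w n).neg
    · exact integrable_mul_of_continuousOn_closedBall μ (continuous_radialCutoff n)
        (fun x hx => radialCutoff_of_one_le hx) hc
    · exact integrable_mul_of_continuousOn_closedBall μ (continuous_radialCutoff n)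
        (fun x hx => radialCutoff_of_one_le hx) hh
  have hpolar : ∀ n : ℕ, ∫ x, w n x * h x ∂μ = ∫ r in Icc (0 : ℝ) 1, radialPeak n r • Q r := by
    intro n
    rw [integral_polar μ (hint_w n), integral_Icc_eq_integral_Ioc]
    have hpt : ∀ r ∈ Ioi (0 : ℝ), r ^ (Module.finrank ℝ V - 1) *
        ∫ u : sphere (0 : V) 1, w n (r • (u : V)) * h (r • (u : V)) ∂μ.toSphere =
        radialPeak n r • Q r := by
      intro r hr
      have hr0 : (0 : ℝ) < r := hr
      have hpt : ∀ u : sphere (0 : V) 1, w n (r • (u : V)) * h (r • (u : V)) =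
          radialPeak n r * (h (r • (u : V)) * inner ℝ (u : V) e) := by
        intro u
        simp only [hw, radialPeak, norm_smul, norm_eq_of_mem_sphere, mul_one, Real.norm_eq_abs,
          sq_abs, real_inner_smul_left]
        ring
      simp only [hQdef, smul_eq_mul, hpt, integral_const_mul]
      ring
    rw [setIntegral_congr_fun measurableSet_Ioi hpt]
    refine setIntegral_eq_of_subset_of_forall_sdiff_eq_zero measurableSet_Ioi
      (fun x hx => hx.1) ?_
    rintro r ⟨hr, hr'⟩
    have hr0 : (0 : ℝ) < r := hr
    have hr1 : 1 < r := by
      by_contra hcon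
      exact hr' ⟨hr, not_lt.1 hcon⟩
    have : (n : ℝ) * (1 - r ^ 2) ≤ 0 :=
      mul_nonpos_of_nonneg_of_nonpos (by positivity) (by nlinarith)
    simp [radialPeak, deriv_smoothTransition_of_nonpos this]
  have hlim1 : Tendsto (fun n : ℕ => ∫ x, radialCutoff n x * fderiv ℝ h x e ∂μ) atTop
      (𝓝 (Q 1)) := by
    simp only [hparts, hpolar]
    exact tendsto_integral_radialPeak hQ
  have hlim2 : Tendsto (fun n : ℕ => ∫ x, radialCutoff n x * fderiv ℝ h x e ∂μ) atTop
      (𝓝 (∫ x, (ball (0 : V) 1).indicator (fun x => fderiv ℝ h x e) x ∂μ)) := by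
    refine tendsto_integral_of_dominated_convergence
      ((closedBall (0 : V) 1).indicator fun x => ‖fderiv ℝ h x e‖) ?_ ?_ ?_ ?_
    · intro n
      exact (integrable_mul_of_continuousOn_closedBall μ (continuous_radialCutoff n)
        (fun x hx => radialCutoff_of_one_le hx) hc).aestronglyMeasurable
    · rw [integrable_indicator_iff measurableSet_closedBall]
      exact hc.norm.integrableOn_compact (isCompact_closedBall _ _)
    · intro n
      refine Eventually.of_forall fun x => ?_
      by_cases hx : x ∈ closedBall (0 : V) 1
      · rw [indicator_of_mem hx, norm_mul, Real.norm_of_nonneg (r := radialCutoff n x)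
          (Real.smoothTransition.nonneg _)]
        exact mul_le_of_le_one_left (norm_nonneg _) (Real.smoothTransition.le_one _)
      · rw [indicator_of_notMem hx]
        rw [mem_closedBall_zero_iff, not_le] at hx
        simp [radialCutoff_of_one_le hx.le]
    · refine Eventually.of_forall fun x => ?_
      by_cases hx : x ∈ ball (0 : V) 1
      · rw [indicator_of_mem hx]
        rw [mem_ball_zero_iff] at hx
        have hpos : 0 < 1 - ‖x‖ ^ 2 := by nlinarith [norm_nonneg x]
        obtain ⟨N, hN⟩ := exists_nat_gt (1 / (1 - ‖x‖ ^ 2))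
        refine tendsto_const_nhds.congr' ?_
        filter_upwards [eventually_ge_atTop N] with n hn
        have hnN : (N : ℝ) ≤ n := by exact_mod_cast hn
        have := (div_lt_iff₀ hpos).1 (hN.trans_le hnN)
        simp [radialCutoff, Real.smoothTransition.one_of_one_le this.le]
      · rw [indicator_of_notMem hx]
        rw [mem_ball_zero_iff, not_lt] at hx
        simp [radialCutoff_of_one_le hx]
  have := tendsto_nhds_unique hlim1 hlim2
  rw [integral_indicator measurableSet_ball] at this
  rw [← hQ1, this]
  refine setIntegral_congr_set ?_
  rw [← ball_union_sphere]
  have : μ (sphere (0 : V) 1) = 0 := Measure.addHaar_sphere μ 0 1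
  exact union_ae_eq_left_of_ae_eq_empty (ae_eq_empty.2 this)

end Divergence

/-! ### Smoothness of averaged losses, and the smoothed objective. -/

section Smoothness

open Set Metric Filter Topology

/-- First order Taylor estimate for a function with Lipschitz gradient on a convex set. -/
theorem LSmoothOn.abs_sub_sub_inner_le {d : ℕ} {L : ℝ} {g : E d → ℝ} {C : Set (E d)}
    (hg : LSmoothOn L g C) (hL : 0 ≤ L) (hC : Convex ℝ C) {x y : E d} (hx : x ∈ C) (hy : y ∈ C) :
    |g y - g x - inner ℝ (gradient g x) (y - x)| ≤ L * ‖y - x‖ ^ 2 := by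
  have hseg : segment ℝ x y ⊆ C := hC.segment_subset hx hy
  have hb : ∀ w ∈ segment ℝ x y, ‖fderiv ℝ g w - fderiv ℝ g x‖ ≤ L * ‖y - x‖ := by
    intro w hw
    rw [← toDual_gradient, ← toDual_gradient, ← map_sub, LinearIsometryEquiv.norm_map]
    refine (hg.2 w (hseg hw) x hx).trans (mul_le_mul_of_nonneg_left ?_ hL)
    have := norm_sub_le_of_mem_segment hw
    simpa using this
  -- The mean value inequality loses the factor 1/2 of the sharp Taylor bound, which only affects
  -- constants.
  have := (convex_segment x y).norm_image_sub_le_of_norm_fderiv_le'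
    (fun w hw => hg.1 w (hseg hw)) hb (left_mem_segment ℝ x y) (right_mem_segment ℝ x y)
  rw [inner_gradient_left, ← Real.norm_eq_abs]
  refine this.trans_eq (by ring)

theorem LSmoothOn.mono {d : ℕ} {L : ℝ} {g : E d → ℝ} {A B : Set (E d)}
    (hg : LSmoothOn L g B) (h : A ⊆ B) : LSmoothOn L g A :=
  ⟨fun x hx => hg.1 x (h hx), fun x hx y hy => hg.2 x (h hx) y (h hy)⟩

theorem LSmoothOn.continuousOn_gradient {d : ℕ} {L : ℝ} {g : E d → ℝ} {A : Set (E d)}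
    (hg : LSmoothOn L g A) (hL : 0 ≤ L) : ContinuousOn (gradient g) A := by
  refine LipschitzOnWith.continuousOn (K := ⟨L, hL⟩) (LipschitzOnWith.of_dist_le_mul ?_)
  intro x hx y hy
  rw [dist_eq_norm, dist_eq_norm]
  exact hg.2 x hx y hy

theorem LSmoothOn.continuousOn {d : ℕ} {L : ℝ} {g : E d → ℝ} {A : Set (E d)}
    (hg : LSmoothOn L g A) : ContinuousOn g A :=
  fun x hx => (hg.1 x hx).continuousAt.continuousWithinAt

/-- Differentiation under the integral sign for functions with uniformly Lipschitz gradients: no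
bound on the gradients themselves is needed. -/
theorem hasGradientAt_integral_of_lsmoothOn {d : ℕ} {S : Type*} [MeasurableSpace S]
    {ν : Measure S} [IsProbabilityMeasure ν] {H : E d → S → ℝ} {L r : ℝ} (hL : 0 ≤ L) (hr : 0 < r)
    {x : E d} (hint : ∀ y ∈ ball x r, Integrable (H y) ν)
    (hsm : ∀ᵐ s ∂ν, LSmoothOn L (fun y => H y s) (ball x r)) :
    Integrable (fun s => gradient (fun y => H y s) x) ν ∧
      HasGradientAt (fun y => ∫ s, H y s ∂ν) (∫ s, gradient (fun y => H y s) x ∂ν) x := by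
  have hx : x ∈ ball x r := mem_ball_self hr
  have hquad : ∀ᵐ s ∂ν, ∀ y ∈ ball x r,
      |H y s - H x s - inner ℝ (gradient (fun y => H y s) x) (y - x)| ≤ L * ‖y - x‖ ^ 2 := by
    filter_upwards [hsm] with s hs y hy
    exact hs.abs_sub_sub_inner_le hL (convex_ball x r) hx hy
  have hG : Integrable (fun s => gradient (fun y => H y s) x) ν := by
    refine Integrable.of_eval_piLp fun i => ?_
    set e : E d := EuclideanSpace.single i (1 : ℝ) with he
    have hcoord : ∀ s, (gradient (fun y => H y s) x) i =
        inner ℝ (gradient (fun y => H y s) x) e := by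
      intro s
      rw [he, EuclideanSpace.inner_single_right]
      simp
    simp only [hcoord]
    -- Difference quotients with steps 1/(n + N) converge to the partial derivative, which gives
    -- measurability; the shift by N keeps every point in the ball. Integrability needs only the
    -- single step c = 1/N: the Taylor estimate bounds c |⟨∇H, e⟩| by an integrable difference plus
    -- a constant.
    obtain ⟨N, hN⟩ := exists_nat_gt (1 / r)
    have hNpos : (0 : ℝ) < N := lt_trans (by positivity) hN
    have hmem : ∀ n : ℕ, x + ((n : ℝ) + N)⁻¹ • e ∈ ball x r := by
      intro n
      rw [mem_ball, dist_eq_norm, add_sub_cancel_left, norm_smul, he, PiLp.norm_single]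
      have h0 : (0 : ℝ) < n + N := by positivity
      rw [Real.norm_of_nonneg (by positivity)]
      simp only [norm_one, mul_one]
      rw [inv_lt_comm₀ h0 hr, ← one_div]
      have : (0 : ℝ) ≤ n := by positivity
      linarith
    have hmeas : AEStronglyMeasurable
        (fun s => inner ℝ (gradient (fun y => H y s) x) e) ν := by
      refine aestronglyMeasurable_of_tendsto_ae atTop
        (f := fun (n : ℕ) s => ((n : ℝ) + N) • (H (x + ((n : ℝ) + N)⁻¹ • e) s - H x s)) ?_ ?_
      · intro n
        exact (((hint _ (hmem n)).sub (hint x hx)).const_mul ((n : ℝ) + N)).aestronglyMeasurable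
      · filter_upwards [hsm] with s hs
        rw [inner_gradient_left]
        refine (hs.1 x hx).hasFDerivAt.lim e ?_
        refine tendsto_norm_atTop_atTop.comp ?_
        exact tendsto_atTop_add_const_right _ _ tendsto_natCast_atTop_atTop
    set c : ℝ := (N : ℝ)⁻¹ with hc
    have hcpos : 0 < c := by positivity
    have hmem0 : x + c • e ∈ ball x r := by simpa using hmem 0
    refine Integrable.mono' (g := fun s => c⁻¹ * (‖H (x + c • e) s - H x s‖ +
      L * ‖c • e‖ ^ 2)) ?_ hmeas ?_
    · exact ((((hint _ hmem0).sub (hint x hx)).norm).add (integrable_const _)).const_mul _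
    · filter_upwards [hquad] with s hs
      have h1 := hs _ hmem0
      rw [add_sub_cancel_left, inner_smul_right] at h1
      have h2 : c * |inner ℝ (gradient (fun y => H y s) x) e| ≤
          ‖H (x + c • e) s - H x s‖ + L * ‖c • e‖ ^ 2 := by
        rw [← abs_of_pos hcpos, ← abs_mul, abs_of_pos hcpos, Real.norm_eq_abs]
        have := abs_sub_abs_le_abs_sub (c * inner ℝ (gradient (fun y => H y s) x) e)
          (H (x + c • e) s - H x s)
        rw [abs_sub_comm (c * _)] at this
        linarith
      rw [Real.norm_eq_abs, inv_mul_eq_div, le_div_iff₀ hcpos]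
      linarith
  refine ⟨hG, ?_⟩
  rw [hasGradientAt_iff_isLittleO]
  have hbound : ∀ y ∈ ball x r, ‖(∫ s, H y s ∂ν) - (∫ s, H x s ∂ν) -
      inner ℝ (∫ s, gradient (fun y => H y s) x ∂ν) (y - x)‖ ≤ L * ‖y - x‖ ^ 2 := by
    intro y hy
    have hI : Integrable (fun s => inner ℝ (gradient (fun y => H y s) x) (y - x)) ν :=
      hG.inner_const _
    have h1 : inner ℝ (∫ s, gradient (fun y => H y s) x ∂ν) (y - x) =
        ∫ s, inner ℝ (gradient (fun y => H y s) x) (y - x) ∂ν := by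
      rw [real_inner_comm, ← integral_inner hG]
      simp only [real_inner_comm]
    rw [h1, ← integral_sub (hint y hy) (hint x hx), ← integral_sub _ hI]
    · refine (norm_integral_le_of_norm_le_const (C := L * ‖y - x‖ ^ 2) ?_).trans (by simp)
      filter_upwards [hquad] with s hs
      exact hs y hy
    · exact (hint y hy).sub (hint x hx)
  have hO : (fun y => (∫ s, H y s ∂ν) - (∫ s, H x s ∂ν) -
      inner ℝ (∫ s, gradient (fun y => H y s) x ∂ν) (y - x)) =O[𝓝 x]
      fun y => ‖y - x‖ ^ 2 := by
    refine Asymptotics.IsBigO.of_bound L ?_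
    filter_upwards [ball_mem_nhds x hr] with y hy
    rw [Real.norm_of_nonneg (by positivity : 0 ≤ ‖y - x‖ ^ 2)]
    exact hbound y hy
  refine hO.trans_isLittleO ?_
  have := (Asymptotics.isLittleO_norm_pow_id (E' := E d) one_lt_two)
  have hsub : Tendsto (fun y : E d => y - x) (𝓝 x) (𝓝 0) := by
    have : Tendsto (fun y : E d => y - x) (𝓝 x) (𝓝 (x - x)) :=
      (continuous_id.sub continuous_const).tendsto x
    simpa using this
  exact this.comp_tendsto hsub

/-- If every loss is `L`-smooth on an open set, then so is the objective, and its gradient is the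
expectation of the gradients of the losses. -/
theorem lsmoothOn_integral {d : ℕ} {S : Type*} [MeasurableSpace S] {ν : Measure S}
    [IsProbabilityMeasure ν] {H : E d → S → ℝ} {L : ℝ} (hL : 0 ≤ L) {U : Set (E d)}
    (hU : IsOpen U) (hint : ∀ y ∈ U, Integrable (H y) ν)
    (hsm : ∀ᵐ s ∂ν, LSmoothOn L (fun y => H y s) U) :
    LSmoothOn L (fun y => ∫ s, H y s ∂ν) U ∧ ∀ x ∈ U,
      gradient (fun y => ∫ s, H y s ∂ν) x = ∫ s, gradient (fun y => H y s) x ∂ν := by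
  have key : ∀ x ∈ U, Integrable (fun s => gradient (fun y => H y s) x) ν ∧
      HasGradientAt (fun y => ∫ s, H y s ∂ν) (∫ s, gradient (fun y => H y s) x ∂ν) x := by
    intro x hx
    obtain ⟨r, hr, hball⟩ := Metric.isOpen_iff.1 hU x hx
    exact hasGradientAt_integral_of_lsmoothOn hL hr (fun y hy => hint y (hball hy))
      (hsm.mono fun s hs => hs.mono hball)
  refine ⟨⟨fun x hx => (key x hx).2.differentiableAt, fun x hx y hy => ?_⟩,
    fun x hx => (key x hx).2.gradient⟩
  rw [(key x hx).2.gradient, (key y hy).2.gradient, ← integral_sub (key x hx).1 (key y hy).1]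
  refine (norm_integral_le_of_norm_le_const (C := L * ‖x - y‖) ?_).trans (by simp)
  filter_upwards [hsm] with s hs
  exact hs.2 x hx y hy

/-- The uniform distribution over the closed unit ball. -/
def uniformBall (d : ℕ) : Measure (E d) :=
  (volume.restrict (closedBall (0 : E d) 1) univ)⁻¹ • volume.restrict (closedBall (0 : E d) 1)

instance isProbabilityMeasure_uniformBall (d : ℕ) : IsProbabilityMeasure (uniformBall d) := by
  have h1 : IsFiniteMeasure (volume.restrict (closedBall (0 : E d) 1)) :=
    ⟨by simpa using measure_closedBall_lt_top⟩
  have h2 : NeZero (volume.restrict (closedBall (0 : E d) 1)) :=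
    ⟨by
      rw [Ne, Measure.restrict_eq_zero]
      exact (measure_closedBall_pos volume (0 : E d) one_pos).ne'⟩
  exact isProbabilityMeasureSMul

theorem ae_uniformBall_mem {d : ℕ} : ∀ᵐ u ∂uniformBall d, u ∈ closedBall (0 : E d) 1 :=
  Measure.ae_smul_measure (ae_restrict_mem measurableSet_closedBall) _

theorem gradient_comp_add_right {d : ℕ} (f : E d → ℝ) (a x : E d) :
    gradient (fun y => f (y + a)) x = gradient f (x + a) := by
  simp only [gradient, fderiv_comp_add_right]

theorem gradient_comp_add_smul {d : ℕ} (f : E d → ℝ) (a : E d) (β : ℝ) (u : E d)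
    (hf : DifferentiableAt ℝ f (a + β • u)) :
    HasGradientAt (fun v => f (a + β • v)) (β • gradient f (a + β • u)) u := by
  rw [hasGradientAt_iff_hasFDerivAt]
  have h1 : HasFDerivAt (fun v : E d => a + β • v) (β • ContinuousLinearMap.id ℝ (E d)) u :=
    ((hasFDerivAt_id u).const_smul β).const_add a
  refine (hf.hasFDerivAt.comp u h1).congr_fderiv ?_
  ext v
  simp

theorem add_smul_mem_closedBall {d : ℕ} {β : ℝ} (hβ : 0 ≤ β) (x : E d) {u : E d}
    (hu : u ∈ closedBall (0 : E d) 1) : x + β • u ∈ closedBall x β := by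
  rw [mem_closedBall_zero_iff] at hu
  rw [mem_closedBall, dist_eq_norm, add_sub_cancel_left, norm_smul, Real.norm_of_nonneg hβ]
  exact mul_le_of_le_one_right hβ hu

/-- The smoothed function is `L`-smooth, and its gradient is the average gradient. -/
theorem lsmoothOn_ballSmoothing {d : ℕ} {f : E d → ℝ} {L β : ℝ} (hL : 0 ≤ L) (hβ : 0 ≤ β)
    {U X : Set (E d)} (hU : IsOpen U) (hX : IsCompact X) (hXU : cthickening β X ⊆ U)
    (hf : LSmoothOn L f U) :
    LSmoothOn L (ballSmoothing β f) X ∧ ∀ x ∈ X, gradient (ballSmoothing β f) x =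
      ∫ u, gradient f (x + β • u) ∂uniformBall d := by
  -- By compactness the closed β-neighbourhood of `X` has a uniform margin δ inside `U`. Hence y +
  -- βu stays in `U` for y in an open neighbourhood of `X`, as differentiation at points of `X`
  -- requires.
  obtain ⟨δ, hδ, hδU⟩ := (hX.cthickening (r := β)).exists_thickening_subset_open hU hXU
  have hmem : ∀ y ∈ thickening δ X, ∀ u ∈ closedBall (0 : E d) 1, y + β • u ∈ U := by
    intro y hy u hu
    obtain ⟨x, hx, hxy⟩ := mem_thickening_iff.1 hy
    refine hδU (mem_thickening_iff.2 ⟨x + β • u, ?_, by simpa using hxy⟩)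
    exact closedBall_subset_cthickening hx β (add_smul_mem_closedBall hβ x hu)
  have hint : ∀ y ∈ thickening δ X, Integrable (fun u => f (y + β • u)) (uniformBall d) := by
    intro y hy
    have h1 : ContinuousOn (fun u => f (y + β • u)) (closedBall (0 : E d) 1) :=
      hf.continuousOn.comp (by fun_prop) (fun u hu => hmem y hy u hu)
    have h2 : IntegrableOn (fun u => f (y + β • u)) (closedBall (0 : E d) 1) :=
      h1.integrableOn_compact (isCompact_closedBall _ _)
    refine Integrable.smul_measure h2 ?_
    simpa using (measure_closedBall_pos volume (0 : E d) one_pos).ne'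
  have hsm : ∀ᵐ u ∂uniformBall d, LSmoothOn L (fun y => f (y + β • u)) (thickening δ X) := by
    filter_upwards [ae_uniformBall_mem] with u hu
    refine ⟨fun y hy => ?_, fun y hy y' hy' => ?_⟩
    · exact (differentiableAt_comp_add_right _).2 (hf.1 _ (hmem y hy u hu))
    · rw [gradient_comp_add_right, gradient_comp_add_right]
      simpa using hf.2 _ (hmem y hy u hu) _ (hmem y' hy' u hu)
  obtain ⟨h1, h2⟩ := lsmoothOn_integral hL isOpen_thickening hint hsm
  have hXt : X ⊆ thickening δ X := self_subset_thickening hδ X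
  refine ⟨h1.mono hXt, fun x hx => ?_⟩
  have := h2 x (hXt hx)
  simp only [gradient_comp_add_right] at this
  exact this

end Smoothness

/-! ### Mean and second moments of the gradient estimator. -/

section Estimator

open Set Metric Filter Topology

theorem isProbabilityMeasure_uniformSphere {d : ℕ} (hd : 1 ≤ d) :
    IsProbabilityMeasure (uniformSphere d) := by
  have : Nonempty (Fin d) := ⟨⟨0, hd⟩⟩
  have h2 : NeZero (volume : Measure (E d)).toSphere := ⟨Measure.toSphere_ne_zero _⟩
  exact isProbabilityMeasureSMul

/-- Stokes' formula relating the uniform distributions over the sphere and over the ball, tested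
against a constant vector. -/
theorem mul_integral_uniformSphere_mul_inner {d : ℕ} (hd : 1 ≤ d) {h : E d → ℝ}
    (hh : ∀ x ∈ closedBall (0 : E d) 1, DifferentiableAt ℝ h x)
    (hc : ContinuousOn (gradient h) (closedBall 0 1)) (e : E d) :
    (d : ℝ) * ∫ u, h u * inner ℝ (u : E d) e ∂uniformSphere d =
      ∫ x, inner ℝ (gradient h x) e ∂uniformBall d := by
  have : Nonempty (Fin d) := ⟨⟨0, hd⟩⟩
  have hd0 : (d : ℝ) ≠ 0 := by positivity
  have key := setIntegral_closedBall_fderiv (volume : Measure (E d)) hh e (by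
    simp only [← inner_gradient_left]
    exact hc.inner continuousOn_const)
  -- The surface measure has total mass d times the volume of the ball, so the two normalizations
  -- differ by the factor d.
  rw [uniformSphere, uniformBall, integral_smul_measure, integral_smul_measure, ← key]
  simp only [inner_gradient_left, Measure.toSphere_apply_univ, finrank_euclideanSpace,
    Fintype.card_fin, Measure.restrict_apply_univ, smul_eq_mul, ENNReal.toReal_inv,
    ENNReal.toReal_mul, ENNReal.toReal_natCast, Measure.addHaar_closedBall_eq_addHaar_ball]
  field_simp

theorem integrable_uniformSphere_of_continuous {d : ℕ} (hd : 1 ≤ d) {V : Type*}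
    [NormedAddCommGroup V] {g : sphere (0 : E d) 1 → V} (hg : Continuous g) :
    Integrable g (uniformSphere d) := by
  have := isProbabilityMeasure_uniformSphere hd
  rw [← integrableOn_univ]
  exact hg.continuousOn.integrableOn_compact isCompact_univ

/-- Stokes' formula relating the uniform distributions over the sphere and over the ball. -/
theorem smul_integral_uniformSphere_smul {d : ℕ} (hd : 1 ≤ d) {h : E d → ℝ}
    (hh : ∀ x ∈ closedBall (0 : E d) 1, DifferentiableAt ℝ h x)
    (hc : ContinuousOn (gradient h) (closedBall 0 1)) :
    (d : ℝ) • ∫ u, h u • (u : E d) ∂uniformSphere d = ∫ x, gradient h x ∂uniformBall d := by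
  have hcont : Continuous fun u : sphere (0 : E d) 1 => h u := by
    have : ContinuousOn h (closedBall 0 1) :=
      fun x hx => (hh x hx).continuousAt.continuousWithinAt
    exact this.comp_continuous continuous_subtype_val (fun u => sphere_subset_closedBall u.2)
  have hI1 : Integrable (fun u : sphere (0 : E d) 1 => h u • (u : E d)) (uniformSphere d) :=
    integrable_uniformSphere_of_continuous hd (hcont.smul continuous_subtype_val)
  have hI2 : Integrable (gradient h) (uniformBall d) := by
    have h2 : IntegrableOn (gradient h) (closedBall (0 : E d) 1) :=
      hc.integrableOn_compact (isCompact_closedBall _ _)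
    refine Integrable.smul_measure h2 ?_
    simpa using (measure_closedBall_pos volume (0 : E d) one_pos).ne'
  refine ext_inner_left ℝ fun e => ?_
  rw [inner_smul_right, ← integral_inner hI1, ← integral_inner hI2]
  have := mul_integral_uniformSphere_mul_inner hd hh hc e
  simp only [real_inner_comm e, real_inner_smul_right] at this ⊢
  exact this

/-- Stokes' formula for the constant function 1. It removes the baseline term f(x) from the mean of
the estimator. -/
theorem integral_uniformSphere_coe {d : ℕ} (hd : 1 ≤ d) :
    ∫ u, (u : E d) ∂uniformSphere d = 0 := by
  have hg : gradient (fun _ : E d => (1 : ℝ)) = 0 := by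
    ext1 x
    exact gradient_fun_const x 1
  have := smul_integral_uniformSphere_smul (h := fun _ => (1 : ℝ)) hd (fun x _ => by simp)
    (by rw [hg]; exact continuousOn_const)
  rw [hg] at this
  have hd0 : (d : ℝ) ≠ 0 := by positivity
  simpa [hd0] using this

/-- The second moment of the uniform distribution over the sphere is isotropic. -/
theorem mul_integral_uniformSphere_inner_sq {d : ℕ} (hd : 1 ≤ d) (a : E d) :
    (d : ℝ) * ∫ u, (inner ℝ a (u : E d)) ^ 2 ∂uniformSphere d = ‖a‖ ^ 2 := by
  have hga : ∀ x : E d, HasGradientAt (fun y : E d => inner ℝ a y) a x := by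
    intro x
    rw [hasGradientAt_iff_hasFDerivAt]
    exact (innerSL ℝ a).hasFDerivAt
  have hg : gradient (fun y : E d => inner ℝ a y) = fun _ => a := by
    ext1 x
    exact (hga x).gradient
  -- Stokes' formula for the linear function ⟨a, ·⟩, whose gradient is constantly `a`, tested
  -- against `a` itself.
  have := mul_integral_uniformSphere_mul_inner (h := fun y : E d => inner ℝ a y) hd
    (fun x _ => (hga x).differentiableAt) (by rw [hg]; exact continuousOn_const) a
  rw [hg] at this
  simp only [integral_const, probReal_univ, one_smul, real_inner_self_eq_norm_sq] at this
  rw [← this]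
  congr 2
  ext u
  rw [sq, real_inner_comm a]

theorem measurable_uniGE {d : ℕ} {S : Type*} [MeasurableSpace S] {F : E d → S → ℝ}
    (hF : Measurable (Function.uncurry F)) (β : ℝ) :
    Measurable fun q : E d × S × sphere (0 : E d) 1 =>
      uniGE β (fun y => F y q.2.1) (q.2.2 : E d) q.1 := by
  have h1 : Measurable fun q : E d × S × sphere (0 : E d) 1 =>
      F (q.1 + β • (q.2.2 : E d)) q.2.1 :=
    hF.comp ((by fun_prop : Measurable fun q : E d × S × sphere (0 : E d) 1 =>
      q.1 + β • (q.2.2 : E d)).prodMk (by fun_prop))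
  have h2 : Measurable fun q : E d × S × sphere (0 : E d) 1 => F q.1 q.2.1 :=
    hF.comp (by fun_prop : Measurable fun q : E d × S × sphere (0 : E d) 1 => (q.1, q.2.1))
  unfold uniGE
  fun_prop

theorem measurable_uniGE_apply {d : ℕ} {S : Type*} [MeasurableSpace S] {F : E d → S → ℝ}
    (hF : Measurable (Function.uncurry F)) (β : ℝ) (x : E d) :
    Measurable fun p : S × sphere (0 : E d) 1 => uniGE β (fun y => F y p.1) (p.2 : E d) x := by
  have h1 : Measurable fun p : S × sphere (0 : E d) 1 => F (x + β • (p.2 : E d)) p.1 :=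
    hF.comp ((by fun_prop : Measurable fun p : S × sphere (0 : E d) 1 =>
      x + β • (p.2 : E d)).prodMk (by fun_prop))
  have h2 : Measurable fun p : S × sphere (0 : E d) 1 => F x p.1 :=
    hF.comp (by fun_prop : Measurable fun p : S × sphere (0 : E d) 1 => (x, p.1))
  unfold uniGE
  fun_prop

theorem memLp_two_of_lintegral {α V : Type*} [MeasurableSpace α] {ν : Measure α}
    [NormedAddCommGroup V] {f : α → V} (hf : AEStronglyMeasurable f ν)
    (h : ∫⁻ a, ‖f a‖ₑ ^ 2 ∂ν ≠ ⊤) : MemLp f 2 ν := by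
  refine ⟨hf, ?_⟩
  rw [eLpNorm_lt_top_iff_lintegral_rpow_enorm_lt_top (by norm_num) (by norm_num)]
  simpa using h.lt_top

namespace Assumptions

variable {d : ℕ} {S : Type*} [MeasurableSpace S] {μ : Measure S}
  {F : E d → S → ℝ} {X : Set (E d)} {β L D σ Δ : ℝ}

theorem measurable_estimator (h : Assumptions μ F X β L D σ Δ) (x : E d) :
    Measurable fun p : S × sphere (0 : E d) 1 => uniGE β (fun y => F y p.1) (p.2 : E d) x :=
  measurable_uniGE_apply h.measurable β x

/-- Pointwise expansion of the difference of two estimators with the same sample. -/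
theorem norm_estimator_sub_sq_le (h : Assumptions μ F X β L D σ Δ) (hL : 0 ≤ L)
    (hβ : 0 < β) {x y : E d} (hx : x ∈ X) (hy : y ∈ X) (s : S) (u : sphere (0 : E d) 1) :
    ‖uniGE β (fun y => F y s) (u : E d) y - uniGE β (fun y => F y s) (u : E d) x‖ ^ 2 ≤
      2 * d ^ 2 * (inner ℝ (gradient (fun y => F y s) y - gradient (fun y => F y s) x)
        (u : E d)) ^ 2 + 8 * (L * (d * β)) ^ 2 := by
  obtain ⟨U, hU, hXU, hint, hsm⟩ := h.smooth
  have key : ∀ z ∈ X, |F (z + β • (u : E d)) s - F z s -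
      β * inner ℝ (gradient (fun y => F y s) z) (u : E d)| ≤ L * β ^ 2 := by
    intro z hz
    have h1 : LSmoothOn L (fun y => F y s) (closedBall z β) :=
      (hsm s).mono ((closedBall_subset_cthickening hz β).trans hXU)
    have := h1.abs_sub_sub_inner_le hL (convex_closedBall z β) (mem_closedBall_self hβ.le)
      (add_smul_mem_closedBall hβ.le z (sphere_subset_closedBall u.2))
    rwa [add_sub_cancel_left, inner_smul_right, norm_smul, norm_eq_of_mem_sphere, mul_one,
      Real.norm_of_nonneg hβ.le] at this
  have hkx := abs_le.1 (key x hx)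
  have hky := abs_le.1 (key y hy)
  set a := inner ℝ (gradient (fun y => F y s) x) (u : E d)
  set b := inner ℝ (gradient (fun y => F y s) y) (u : E d)
  rw [inner_sub_left]
  have hrw : uniGE β (fun y => F y s) (u : E d) y - uniGE β (fun y => F y s) (u : E d) x =
      ((d : ℝ) * (F (y + β • (u : E d)) s - F y s - (F (x + β • (u : E d)) s - F x s)) / β) •
        (u : E d) := by
    rw [uniGE, uniGE, ← sub_smul]
    congr 1
    ring
  rw [hrw, norm_smul, norm_eq_of_mem_sphere, mul_one, Real.norm_eq_abs, sq_abs]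
  -- Each of the two increments has a Taylor remainder of at most Lβ², hence |r| ≤ 2Lβ after
  -- division by β. Then (p + q)² ≤ 2p² + 2q² produces the constants 2 and 8.
  obtain ⟨r, hr, hr'⟩ : ∃ r : ℝ, F (y + β • (u : E d)) s - F y s -
      (F (x + β • (u : E d)) s - F x s) = β * (b - a) + β * r ∧ r ^ 2 ≤ (2 * L * β) ^ 2 := by
    refine ⟨(F (y + β • (u : E d)) s - F y s - (F (x + β • (u : E d)) s - F x s)) / β - (b - a),
      by field_simp; ring, ?_⟩
    refine sq_le_sq' ?_ ?_
    · rw [le_sub_iff_add_le, le_div_iff₀ hβ]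
      nlinarith
    · rw [sub_le_iff_le_add, div_le_iff₀ hβ]
      nlinarith
  rw [hr, show (d : ℝ) * (β * (b - a) + β * r) / β = d * (b - a) + d * r by field_simp]
  have hd2 : (0 : ℝ) ≤ (d : ℝ) ^ 2 := by positivity
  nlinarith [sq_nonneg ((d : ℝ) * (b - a) - d * r), mul_le_mul_of_nonneg_left hr' hd2]

variable [IsProbabilityMeasure μ]

theorem lsmoothOn_objective (h : Assumptions μ F X β L D σ Δ) (hL : 0 ≤ L) :
    ∃ U : Set (E d), IsOpen U ∧ cthickening β X ⊆ U ∧ LSmoothOn L (objective μ F) U ∧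
      (∀ x ∈ U, Integrable (F x) μ) ∧ ∀ s, LSmoothOn L (fun x => F x s) U := by
  obtain ⟨U, hU, hXU, hint, hsm⟩ := h.smooth
  exact ⟨U, hU, hXU, (lsmoothOn_integral hL hU hint (Eventually.of_forall hsm)).1, hint, hsm⟩

theorem lsmoothOn_smoothed (h : Assumptions μ F X β L D σ Δ) (hL : 0 ≤ L) (hβ : 0 ≤ β) :
    LSmoothOn L (ballSmoothing β (objective μ F)) X := by
  obtain ⟨U, hU, hXU, hf, -, -⟩ := h.lsmoothOn_objective hL
  exact (lsmoothOn_ballSmoothing hL hβ hU h.compact hXU hf).1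

theorem lsmoothOn_objective_feasible (h : Assumptions μ F X β L D σ Δ) (hL : 0 ≤ L) :
    LSmoothOn L (objective μ F) X := by
  obtain ⟨U, hU, hXU, hf, -, -⟩ := h.lsmoothOn_objective hL
  exact hf.mono ((self_subset_cthickening X).trans hXU)

/-- The bias of the smoothed gradient. -/
theorem norm_gradient_smoothed_sub_le (h : Assumptions μ F X β L D σ Δ) (hL : 0 ≤ L)
    (hβ : 0 ≤ β) {x : E d} (hx : x ∈ X) :
    ‖gradient (ballSmoothing β (objective μ F)) x - gradient (objective μ F) x‖ ≤ L * β := by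
  obtain ⟨U, hU, hXU, hf, -, -⟩ := h.lsmoothOn_objective hL
  rw [(lsmoothOn_ballSmoothing hL hβ hU h.compact hXU hf).2 x hx]
  have hmem : ∀ u ∈ closedBall (0 : E d) 1, x + β • u ∈ U := fun u hu =>
    hXU (closedBall_subset_cthickening hx β (add_smul_mem_closedBall hβ x hu))
  have hxU : x ∈ U := hXU (self_subset_cthickening X hx)
  have hI : Integrable (fun u => gradient (objective μ F) (x + β • u)) (uniformBall d) := by
    have h1 : ContinuousOn (fun u => gradient (objective μ F) (x + β • u))
        (closedBall (0 : E d) 1) :=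
      (hf.continuousOn_gradient hL).comp (by fun_prop) hmem
    have h2 : IntegrableOn (fun u => gradient (objective μ F) (x + β • u))
        (closedBall (0 : E d) 1) := h1.integrableOn_compact (isCompact_closedBall _ _)
    refine Integrable.smul_measure h2 ?_
    simpa using (measure_closedBall_pos volume (0 : E d) one_pos).ne'
  have hconst : gradient (objective μ F) x =
      ∫ _u, gradient (objective μ F) x ∂uniformBall d := by simp
  rw [hconst, ← integral_sub hI (integrable_const _)]
  refine (norm_integral_le_of_norm_le_const (C := L * β) ?_).trans (by simp)
  filter_upwards [ae_uniformBall_mem] with u hu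
  refine (hf.2 _ (hmem u hu) x hxU).trans (mul_le_mul_of_nonneg_left ?_ hL)
  have := add_smul_mem_closedBall hβ x hu
  rwa [mem_closedBall, dist_eq_norm] at this

/-- The variance assumption is a bound on a Lebesgue integral in [0, ∞], so it already contains the
finiteness of the second moment. -/
theorem memLp_estimator (h : Assumptions μ F X β L D σ Δ) (hd : 1 ≤ d) {x : E d} (hx : x ∈ X) :
    MemLp (fun p : S × sphere (0 : E d) 1 => uniGE β (fun y => F y p.1) (p.2 : E d) x) 2
      (μ.prod (uniformSphere d)) := by
  have := isProbabilityMeasure_uniformSphere hd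
  have h1 : MemLp (fun p : S × sphere (0 : E d) 1 => uniGE β (fun y => F y p.1) (p.2 : E d) x -
      gradient (ballSmoothing β (objective μ F)) x) 2 (μ.prod (uniformSphere d)) := by
    refine memLp_two_of_lintegral ?_ ((h.variance x hx).trans_lt ENNReal.ofReal_lt_top).ne
    exact ((h.measurable_estimator x).sub measurable_const).aestronglyMeasurable
  have h2 := h1.add (memLp_const (gradient (ballSmoothing β (objective μ F)) x))
  refine h2.ae_eq (Eventually.of_forall fun p => ?_)
  simp

/-- The uniform smoothing gradient estimator is an unbiased estimator of the gradient of the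
smoothed objective. -/
theorem integral_estimator (h : Assumptions μ F X β L D σ Δ) (hd : 1 ≤ d) (hL : 0 ≤ L)
    (hβ : 0 < β) {x : E d} (hx : x ∈ X) :
    ∫ p, uniGE β (fun y => F y p.1) (p.2 : E d) x ∂(μ.prod (uniformSphere d)) =
      gradient (ballSmoothing β (objective μ F)) x := by
  have := isProbabilityMeasure_uniformSphere hd
  obtain ⟨U, hU, hXU, hf, hint, hsm⟩ := h.lsmoothOn_objective hL
  have hmem : ∀ u ∈ closedBall (0 : E d) 1, x + β • u ∈ U := fun u hu =>
    hXU (closedBall_subset_cthickening hx β (add_smul_mem_closedBall hβ.le x hu))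
  have hxU : x ∈ U := hXU (self_subset_cthickening X hx)
  -- Averaging over ξ first replaces the loss by the objective. What remains is Stokes' formula for
  -- v ↦ f(x + βv), whose gradient carries a factor β that cancels the division by β.
  rw [integral_prod_symm _ ((h.memLp_estimator hd hx).integrable (by norm_num))]
  have hinner : ∀ u : sphere (0 : E d) 1, ∫ s, uniGE β (fun y => F y s) (u : E d) x ∂μ =
      ((d : ℝ) / β) • (objective μ F (x + β • (u : E d)) • (u : E d)) -
        ((d : ℝ) / β * objective μ F x) • (u : E d) := by
    intro u
    have hu := hmem u (sphere_subset_closedBall u.2)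
    simp only [uniGE]
    rw [integral_smul_const, integral_div, integral_const_mul, integral_sub (hint _ hu)
      (hint _ hxU), smul_smul, ← sub_smul]
    simp only [objective]
    congr 1
    ring
  simp only [hinner]
  have hgr : ∀ u ∈ closedBall (0 : E d) 1, HasGradientAt
      (fun v => objective μ F (x + β • v)) (β • gradient (objective μ F) (x + β • u)) u :=
    fun u hu => gradient_comp_add_smul _ _ _ _ (hf.1 _ (hmem u hu))
  have hgc : ContinuousOn (gradient fun v => objective μ F (x + β • v)) (closedBall 0 1) := by
    have : ContinuousOn (fun u => β • gradient (objective μ F) (x + β • u))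
        (closedBall (0 : E d) 1) :=
      ((hf.continuousOn_gradient hL).comp (by fun_prop) hmem).const_smul β
    exact this.congr fun u hu => (hgr u hu).gradient
  have hcont : Continuous fun u : sphere (0 : E d) 1 => objective μ F (x + β • (u : E d)) :=
    hf.continuousOn.comp_continuous (by fun_prop)
      (fun u => hmem u (sphere_subset_closedBall u.2))
  rw [integral_sub, integral_smul, integral_smul, integral_uniformSphere_coe hd, smul_zero,
    sub_zero, (lsmoothOn_ballSmoothing hL hβ.le hU h.compact hXU hf).2 x hx, div_eq_inv_mul,
    mul_smul, smul_integral_uniformSphere_smul hd (h := fun v => objective μ F (x + β • v))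
      (fun u hu => (hgr u hu).differentiableAt) hgc]
  · have : ∫ u, gradient (fun v => objective μ F (x + β • v)) u ∂uniformBall d =
        ∫ u, β • gradient (objective μ F) (x + β • u) ∂uniformBall d := by
      refine integral_congr_ae ?_
      filter_upwards [ae_uniformBall_mem] with u hu
      exact (hgr u hu).gradient
    rw [this, integral_smul, smul_smul, inv_mul_cancel₀ hβ.ne', one_smul]
  · exact integrable_uniformSphere_of_continuous hd
      ((hcont.smul continuous_subtype_val).const_smul ((d : ℝ) / β))
  · exact integrable_uniformSphere_of_continuous hd (by fun_prop)

/-- The mean square distance between two estimators with the same sample. -/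
theorem lintegral_estimator_sub_le (h : Assumptions μ F X β L D σ Δ) (hd : 1 ≤ d) (hL : 0 ≤ L)
    (hβ : 0 < β) {x y : E d} (hx : x ∈ X) (hy : y ∈ X) :
    ∫⁻ p, ‖uniGE β (fun y => F y p.1) (p.2 : E d) y
      - uniGE β (fun y => F y p.1) (p.2 : E d) x‖ₑ ^ 2 ∂(μ.prod (uniformSphere d)) ≤
      ENNReal.ofReal (2 * d * (L * ‖y - x‖) ^ 2 + 8 * (L * (d * β)) ^ 2) := by
  have := isProbabilityMeasure_uniformSphere hd
  obtain ⟨U, hU, hXU, hint, hsm⟩ := h.smooth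
  have hXU' : X ⊆ U := (self_subset_cthickening X).trans hXU
  have hmeas : Measurable fun p : S × sphere (0 : E d) 1 =>
      ‖uniGE β (fun y => F y p.1) (p.2 : E d) y
        - uniGE β (fun y => F y p.1) (p.2 : E d) x‖ₑ ^ 2 :=
    ((h.measurable_estimator y).sub (h.measurable_estimator x)).enorm.pow_const 2
  rw [lintegral_prod _ hmeas.aemeasurable]
  -- For a fixed sample, isotropy turns the mean of d² ⟨A, u⟩² into d ‖A‖². The crude bound d² ‖A‖²
  -- would give d in place of √d in the final rate.
  have hs : ∀ s, ∫⁻ u, ‖uniGE β (fun y => F y s) (u : E d) y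
      - uniGE β (fun y => F y s) (u : E d) x‖ₑ ^ 2 ∂uniformSphere d ≤
      ENNReal.ofReal (2 * d * (L * ‖y - x‖) ^ 2 + 8 * (L * (d * β)) ^ 2) := by
    intro s
    set A := gradient (fun y => F y s) y - gradient (fun y => F y s) x with hA
    have hI : Integrable (fun u : sphere (0 : E d) 1 =>
        2 * d ^ 2 * (inner ℝ A (u : E d)) ^ 2 + 8 * (L * (d * β)) ^ 2) (uniformSphere d) :=
      integrable_uniformSphere_of_continuous hd (by fun_prop)
    have hI2 : Integrable (fun u : sphere (0 : E d) 1 =>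
        2 * d ^ 2 * (inner ℝ A (u : E d)) ^ 2) (uniformSphere d) :=
      integrable_uniformSphere_of_continuous hd (by fun_prop)
    calc _ ≤ ∫⁻ u : sphere (0 : E d) 1, ENNReal.ofReal
          (2 * d ^ 2 * (inner ℝ A (u : E d)) ^ 2 + 8 * (L * (d * β)) ^ 2) ∂uniformSphere d := by
          refine lintegral_mono fun u => ?_
          rw [← ofReal_norm, ← ENNReal.ofReal_pow (norm_nonneg _)]
          exact ENNReal.ofReal_le_ofReal (h.norm_estimator_sub_sq_le hL hβ hx hy s u)
      _ = ENNReal.ofReal (2 * d * ‖A‖ ^ 2 + 8 * (L * (d * β)) ^ 2) := by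
          rw [← ofReal_integral_eq_lintegral_ofReal hI
            (Eventually.of_forall fun u => by positivity), integral_add hI2 (integrable_const _),
            integral_const_mul, ← mul_integral_uniformSphere_inner_sq hd A]
          simp only [integral_const, probReal_univ, one_smul]
          congr 2
          ring
      _ ≤ _ := by
          refine ENNReal.ofReal_le_ofReal ?_
          have := (hsm s).2 y (hXU' hy) x (hXU' hx)
          gcongr
  calc _ ≤ ∫⁻ _s, ENNReal.ofReal (2 * d * (L * ‖y - x‖) ^ 2 + 8 * (L * (d * β)) ^ 2) ∂μ :=
        lintegral_mono hs
    _ = _ := by simp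

end Assumptions

end Estimator

/-! ### Deterministic analysis of the accelerated Frank–Wolfe scheme. -/

section FrankWolfe

open Set Metric Filter Topology

theorem parα_pos (t : ℕ) : 0 < parα t := by unfold parα; positivity

theorem parα_le_one (t : ℕ) : parα t ≤ 1 := by
  unfold parα
  rw [div_le_one (by positivity)]
  have : (0 : ℝ) ≤ t := by positivity
  linarith

theorem parθ_pos (t : ℕ) : 0 < parθ t := by unfold parθ; positivity

theorem parθ_le_half (t : ℕ) : parθ t ≤ 1 / 2 := by
  unfold parθ
  have : (0 : ℝ) ≤ t := by positivity
  rw [div_le_div_iff₀ (by positivity) (by positivity)]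
  nlinarith

/-- A deterministic sequence of iterates of the accelerated Frank–Wolfe scheme driven by the
points `w`. -/
structure IsFWPath {d : ℕ} (X : Set (E d)) (T : ℕ) (η : ℝ) (w x y z : ℕ → E d) : Prop where
  init : ∃ x₀ ∈ X, x 0 = x₀ ∧ y 0 = x₀ ∧ z 0 = x₀
  mem : ∀ t < T, w t ∈ X
  step_x : ∀ t < T, x (t + 1) = x t + ((1 + parθ t) * η) • (w t - x t)
  step_y : ∀ t < T, y (t + 1) = z t + η • (w t - z t)
  step_z : ∀ t < T, z (t + 1) = (1 - parα (t + 1)) • y (t + 1) + parα (t + 1) • x (t + 1)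

namespace IsFWPath

variable {d T : ℕ} {X : Set (E d)} {η : ℝ} {w x y z : ℕ → E d}

/-- Since θ_t ≤ 1/2, the threshold 2/3 keeps the step (1 + θ_t) η at most 1, so every update is a
convex combination. -/
theorem iterates_mem (h : IsFWPath X T η w x y z) (hX : Convex ℝ X) (h0 : 0 ≤ η)
    (h1 : η ≤ 2 / 3) : ∀ t ≤ T, x t ∈ X ∧ y t ∈ X ∧ z t ∈ X := by
  intro t
  induction t with
  | zero =>
    intro _
    obtain ⟨x₀, hx₀, hx, hy, hz⟩ := h.init
    rw [hx, hy, hz]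
    exact ⟨hx₀, hx₀, hx₀⟩
  | succ t ih =>
    intro ht
    have htT : t < T := ht
    obtain ⟨hx, hy, hz⟩ := ih htT.le
    have hw := h.mem t htT
    have hθ := parθ_pos t
    have hθ' := parθ_le_half t
    have hxn : x (t + 1) ∈ X := by
      rw [h.step_x t htT]
      exact hX.add_smul_sub_mem hx hw ⟨by positivity, by nlinarith⟩
    have hyn : y (t + 1) ∈ X := by
      rw [h.step_y t htT]
      exact hX.add_smul_sub_mem hz hw ⟨h0, by linarith⟩
    refine ⟨hxn, hyn, ?_⟩
    rw [h.step_z t htT]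
    exact hX hyn hxn (by linarith [parα_le_one (t + 1)]) (parα_pos _).le (by ring)

theorem sub_z (h : IsFWPath X T η w x y z) {t : ℕ} (ht : t ≤ T) :
    x t - z t = (1 - parα t) • (x t - y t) := by
  cases t with
  | zero =>
    obtain ⟨x₀, hx₀, hx, hy, hz⟩ := h.init
    simp [hx, hy, hz]
  | succ t =>
    rw [h.step_z t ht]
    module

/-- The two averaged sequences stay close in every seminorm bounded on `X - X`. -/
theorem seminorm_sub_le (h : IsFWPath X T η w x y z) (hX : Convex ℝ X) (h0 : 0 ≤ η)
    (h1 : η ≤ 2 / 3) (p : Seminorm ℝ (E d)) {R : ℝ}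
    (hp : ∀ a ∈ X, ∀ b ∈ X, p (a - b) ≤ R) : ∀ t ≤ T, p (x t - y t) ≤ η * R := by
  have hR : 0 ≤ R := by
    obtain ⟨x₀, hx₀, -⟩ := h.init
    simpa using hp x₀ hx₀ x₀ hx₀
  intro t
  induction t with
  | zero =>
    intro _
    obtain ⟨x₀, hx₀, hx, hy, hz⟩ := h.init
    simp only [hx, hy, sub_self, map_zero]
    positivity
  | succ t ih =>
    intro ht
    have htT : t < T := ht
    have hq := ih htT.le
    -- The old difference is contracted by at least 1 - α_t and the new contribution is at most θ_t
    -- η R; the bound ηR survives because θ_t ≤ α_t.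
    have hrec : x (t + 1) - y (t + 1) =
        ((1 - (1 + parθ t) * η) * (1 - parα t)) • (x t - y t) + (parθ t * η) • (w t - z t) := by
      rw [mul_smul, ← h.sub_z htT.le, h.step_x t htT, h.step_y t htT]
      module
    have hθ := parθ_pos t
    have hθ' := parθ_le_half t
    have hα := parα_le_one t
    have hγ1 : (1 + parθ t) * η ≤ 1 := by nlinarith
    have hγ0 : 0 ≤ (1 + parθ t) * η := by positivity
    have hwz := hp _ (h.mem t htT) _ (h.iterates_mem hX h0 h1 t htT.le).2.2
    rw [hrec]
    refine (map_add_le_add p _ _).trans ?_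
    rw [map_smul_eq_mul, map_smul_eq_mul, Real.norm_of_nonneg (mul_nonneg (by linarith)
      (by linarith)), Real.norm_of_nonneg (by positivity)]
    have hc : (1 - parα t) + parθ t ≤ 1 := by
      unfold parα parθ
      have : (0 : ℝ) ≤ t := by positivity
      have h3 : 1 / (((t : ℝ) + 1) * ((t : ℝ) + 2)) ≤ 1 / ((t : ℝ) + 1) := by
        refine one_div_le_one_div_of_le (by positivity) ?_
        nlinarith
      linarith
    calc (1 - (1 + parθ t) * η) * (1 - parα t) * p (x t - y t) + parθ t * η * p (w t - z t)
        ≤ (1 - (1 + parθ t) * η) * (1 - parα t) * (η * R) + parθ t * η * R := by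
          gcongr
      _ ≤ 1 * (1 - parα t) * (η * R) + parθ t * η * R := by
          have : 0 ≤ 1 - parα t := by linarith
          gcongr
          linarith
      _ = ((1 - parα t) + parθ t) * (η * R) := by ring
      _ ≤ 1 * (η * R) := by gcongr
      _ = η * R := one_mul _

/-- The coefficient of w_t - z_t is (1 - α_{t+1}) η + α_{t+1} (1 + θ_t) η; the rest is a drift along
x_t - z_t, rewritten by `sub_z`. -/
theorem sub_succ (h : IsFWPath X T η w x y z) {t : ℕ} (ht : t < T) :
    z (t + 1) - z t = (η * (1 + parα (t + 1) * parθ t)) • (w t - z t) +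
      (parα (t + 1) * ((1 - (1 + parθ t) * η) * (1 - parα t))) • (x t - y t) := by
  have : (parα (t + 1) * ((1 - (1 + parθ t) * η) * (1 - parα t))) • (x t - y t) =
      (parα (t + 1) * (1 - (1 + parθ t) * η)) • (x t - z t) := by
    rw [h.sub_z ht.le]
    module
  rw [this, h.step_z t ht, h.step_x t ht, h.step_y t ht]
  module

theorem coeff_mem (h0 : 0 ≤ η) (h1 : η ≤ 2 / 3) (t : ℕ) :
    0 ≤ parα (t + 1) * ((1 - (1 + parθ t) * η) * (1 - parα t)) ∧
      parα (t + 1) * ((1 - (1 + parθ t) * η) * (1 - parα t)) ≤ parα (t + 1) := by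
  have hθ := parθ_pos t
  have hθ' := parθ_le_half t
  have hα := parα_le_one t
  have hα0 := parα_pos t
  have hα1 := parα_pos (t + 1)
  have hγ1 : 0 ≤ 1 - (1 + parθ t) * η := by nlinarith
  have hγ0 : 0 ≤ (1 + parθ t) * η := by positivity
  have h2 : 0 ≤ 1 - parα t := by linarith
  refine ⟨by positivity, mul_le_of_le_one_right hα1.le ?_⟩
  exact mul_le_one₀ (by linarith) h2 (by linarith)

/-- Consecutive iterates are close. -/
theorem norm_sub_succ_le (h : IsFWPath X T η w x y z) (hX : Convex ℝ X) (h0 : 0 ≤ η)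
    (h1 : η ≤ 2 / 3) {D : ℝ} (hD : ∀ a ∈ X, ∀ b ∈ X, ‖a - b‖ ≤ D) {t : ℕ} (ht : t < T) :
    ‖z (t + 1) - z t‖ ≤ 3 * η * D := by
  have hq : ‖x t - y t‖ ≤ η * D :=
    h.seminorm_sub_le hX h0 h1 (normSeminorm ℝ (E d)) hD t ht.le
  have hwz := hD _ (h.mem t ht) _ (h.iterates_mem hX h0 h1 t ht.le).2.2
  have hD0 : 0 ≤ D := (norm_nonneg _).trans hwz
  obtain ⟨hc0, hc1⟩ := coeff_mem h0 h1 t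
  have hθ := parθ_pos t
  have hθ' := parθ_le_half t
  have hα1 := parα_pos (t + 1)
  have hα1' := parα_le_one (t + 1)
  rw [h.sub_succ ht]
  refine (norm_add_le _ _).trans ?_
  rw [norm_smul, norm_smul, Real.norm_of_nonneg (by positivity), Real.norm_of_nonneg hc0]
  have e1 : η * (1 + parα (t + 1) * parθ t) ≤ 2 * η := by
    have : parα (t + 1) * parθ t ≤ 1 * (1 / 2) := by gcongr
    nlinarith
  calc _ ≤ 2 * η * D + 1 * (η * D) := by
        gcongr
        linarith
    _ = 3 * η * D := by ring

end IsFWPath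

/-- Bounds for a smooth function on a convex set of diameter `D` on which it varies by at most
`Δ`. -/
theorem LSmoothOn.abs_inner_gradient_sub_le {d : ℕ} {X : Set (E d)} {f : E d → ℝ} {L D Δ : ℝ}
    (hf : LSmoothOn L f X) (hL : 0 ≤ L) (hX : Convex ℝ X)
    (hD : ∀ a ∈ X, ∀ b ∈ X, ‖a - b‖ ≤ D) (hΔ : ∀ a ∈ X, ∀ b ∈ X, f a - f b ≤ Δ)
    {x y : E d} (hx : x ∈ X) (hy : y ∈ X) :
    |inner ℝ (gradient f x) (y - x)| ≤ Δ + L * D ^ 2 := by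
  have h1 := abs_le.1 (hf.abs_sub_sub_inner_le hL hX hx hy)
  have h2 := hD y hy x hx
  have h3 : L * ‖y - x‖ ^ 2 ≤ L * D ^ 2 := by gcongr
  have h4 := hΔ x hx y hy
  have h5 := hΔ y hy x hx
  rw [abs_le]
  constructor <;> linarith

/-- This replaces a bound on ‖∇f‖, which the assumptions do not supply: the drift only has to be
controlled in the seminorm |⟨∇f(z_t), ·⟩|. -/
theorem LSmoothOn.abs_inner_gradient_sub_le_two_mul {d : ℕ} {X : Set (E d)} {f : E d → ℝ}
    {L D Δ : ℝ} (hf : LSmoothOn L f X) (hL : 0 ≤ L) (hX : Convex ℝ X)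
    (hD : ∀ a ∈ X, ∀ b ∈ X, ‖a - b‖ ≤ D) (hΔ : ∀ a ∈ X, ∀ b ∈ X, f a - f b ≤ Δ)
    {x a b : E d} (hx : x ∈ X) (ha : a ∈ X) (hb : b ∈ X) :
    |inner ℝ (gradient f x) (a - b)| ≤ 2 * (Δ + L * D ^ 2) := by
  have h1 := hf.abs_inner_gradient_sub_le hL hX hD hΔ hx ha
  have h2 := hf.abs_inner_gradient_sub_le hL hX hD hΔ hx hb
  have : inner ℝ (gradient f x) (a - b) =
      inner ℝ (gradient f x) (a - x) - inner ℝ (gradient f x) (b - x) := by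
    rw [← inner_sub_right]
    congr 1
    abel
  rw [this]
  refine (abs_sub _ _).trans ?_
  linarith

theorem LSmoothOn.fwGap_mem_Icc {d : ℕ} {X : Set (E d)} {f : E d → ℝ} {L D Δ : ℝ}
    (hf : LSmoothOn L f X) (hL : 0 ≤ L) (hX : Convex ℝ X)
    (hD : ∀ a ∈ X, ∀ b ∈ X, ‖a - b‖ ≤ D) (hΔ : ∀ a ∈ X, ∀ b ∈ X, f a - f b ≤ Δ)
    {x : E d} (hx : x ∈ X) : fwGap X f x ∈ Icc 0 (Δ + L * D ^ 2) := by
  have hb : ∀ w ∈ X, inner ℝ (w - x) (-gradient f x) ≤ Δ + L * D ^ 2 := by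
    intro w hw
    have := abs_le.1 (hf.abs_inner_gradient_sub_le hL hX hD hΔ hx hw)
    rw [inner_neg_right, real_inner_comm]
    linarith [this.1]
  constructor
  · refine le_csSup ⟨Δ + L * D ^ 2, ?_⟩ ⟨x, hx, by simp⟩
    rintro _ ⟨w, hw, rfl⟩
    exact hb w hw
  · refine csSup_le ⟨_, x, hx, rfl⟩ ?_
    rintro _ ⟨w, hw, rfl⟩
    exact hb w hw

/-- The Frank–Wolfe gap, estimated by a linear minimization with an inexact gradient. -/
theorem fwGap_le_of_isMaxOn {d : ℕ} {X : Set (E d)} {f : E d → ℝ} {D : ℝ}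
    (hD : ∀ a ∈ X, ∀ b ∈ X, ‖a - b‖ ≤ D) {x v w : E d} (hx : x ∈ X) (hw : w ∈ X)
    (hmax : IsMaxOn (fun q => inner ℝ q (-v)) X w) :
    fwGap X f x ≤ -inner ℝ (gradient f x) (w - x) + D * ‖v - gradient f x‖ := by
  refine csSup_le ⟨_, x, hx, rfl⟩ ?_
  rintro _ ⟨a, ha, rfl⟩
  have h1 : inner ℝ a (-v) ≤ inner ℝ w (-v) := hmax ha
  have h2 : inner ℝ (a - w) (v - gradient f x) ≤ D * ‖v - gradient f x‖ :=
    (real_inner_le_norm _ _).trans (by gcongr; exact hD a ha w hw)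
  simp only [inner_sub_left, inner_sub_right, inner_neg_right, real_inner_comm _ (gradient f x)]
    at h1 h2 ⊢
  linarith

/-- Taylor expansion of f from z_t to z_{t+1}, with w_t - z_t paired through `fwGap_le_of_isMaxOn`.
The factor 1 + k, with 0 ≤ k ≤ 1, is dropped in front of the nonnegative gap and bounded by 2 in
front of the gradient error. The 9 is the square of the 3 in the step bound 3ηD. -/
theorem IsFWPath.mul_fwGap_le {d T : ℕ} {X : Set (E d)} {η : ℝ} {w x y z v : ℕ → E d}
    (h : IsFWPath X T η w x y z) (hX : Convex ℝ X) (h0 : 0 ≤ η) (h1 : η ≤ 2 / 3)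
    {f : E d → ℝ} {L D Δ : ℝ} (hf : LSmoothOn L f X) (hL : 0 ≤ L)
    (hD : ∀ a ∈ X, ∀ b ∈ X, ‖a - b‖ ≤ D) (hΔ : ∀ a ∈ X, ∀ b ∈ X, f a - f b ≤ Δ)
    {t : ℕ} (ht : t < T) (hmax : IsMaxOn (fun q => inner ℝ q (-v t)) X (w t)) :
    η * fwGap X f (z t) ≤ f (z t) - f (z (t + 1)) + η * (2 * D * ‖v t - gradient f (z t)‖) +
      η * (2 * (Δ + L * D ^ 2) * parα (t + 1)) + η ^ 2 * (9 * L * D ^ 2) := by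
  have hz := (h.iterates_mem hX h0 h1 t ht.le).2.2
  have hz' := (h.iterates_mem hX h0 h1 (t + 1) ht).2.2
  have hw := h.mem t ht
  have hG0 := (hf.fwGap_mem_Icc hL hX hD hΔ hz).1
  have hG := fwGap_le_of_isMaxOn (f := f) hD hz hw hmax
  have hdesc := (abs_le.1 (hf.abs_sub_sub_inner_le hL hX hz hz')).2
  have hstep := h.norm_sub_succ_le hX h0 h1 hD ht
  have hsq : L * ‖z (t + 1) - z t‖ ^ 2 ≤ η ^ 2 * (9 * L * D ^ 2) := by
    calc _ ≤ L * (3 * η * D) ^ 2 := by gcongr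
      _ = _ := by ring
  set n := gradient f (z t) with hn
  have hq : |inner ℝ n (x t - y t)| ≤ η * (2 * (Δ + L * D ^ 2)) := by
    have := h.seminorm_sub_le hX h0 h1 ((innerSL ℝ n).toLinearMap.toSeminorm)
      (R := 2 * (Δ + L * D ^ 2))
      (fun a ha b hb => hf.abs_inner_gradient_sub_le_two_mul hL hX hD hΔ hz ha hb) t ht.le
    exact this
  obtain ⟨hc0, hc1⟩ := IsFWPath.coeff_mem h0 h1 t
  set c := parα (t + 1) * ((1 - (1 + parθ t) * η) * (1 - parα t)) with hc
  have hθ := parθ_pos t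
  have hθ' := parθ_le_half t
  have hα1 := parα_pos (t + 1)
  have hα1' := parα_le_one (t + 1)
  have hk0 : 0 ≤ parα (t + 1) * parθ t := by positivity
  have hk1 : parα (t + 1) * parθ t ≤ 1 := by nlinarith
  set k := parα (t + 1) * parθ t with hk
  have hinner : inner ℝ n (z (t + 1) - z t) =
      η * (1 + k) * inner ℝ n (w t - z t) + c * inner ℝ n (x t - y t) := by
    rw [h.sub_succ ht, inner_add_right, inner_smul_right, inner_smul_right]
  have hcq : c * inner ℝ n (x t - y t) ≤ η * (2 * (Δ + L * D ^ 2) * parα (t + 1)) := by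
    calc c * inner ℝ n (x t - y t) ≤ c * |inner ℝ n (x t - y t)| := by
          gcongr
          exact le_abs_self _
      _ ≤ parα (t + 1) * (η * (2 * (Δ + L * D ^ 2))) := by gcongr
      _ = _ := by ring
  have hD0 : 0 ≤ D := (norm_nonneg _).trans (hD _ hz _ hz)
  have hDv : 0 ≤ D * ‖v t - n‖ := by positivity
  have h3 : η * (1 + k) * fwGap X f (z t) ≤
      η * (1 + k) * (-inner ℝ n (w t - z t) + D * ‖v t - n‖) := by gcongr
  have h4 : η * fwGap X f (z t) ≤ η * (1 + k) * fwGap X f (z t) := by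
    have : 0 ≤ η * k * fwGap X f (z t) := by positivity
    nlinarith
  have h5 : η * (1 + k) * (D * ‖v t - n‖) ≤ η * (2 * D * ‖v t - n‖) := by
    have : 0 ≤ η * (D * ‖v t - n‖) := by positivity
    nlinarith
  rw [hinner] at hdesc
  linarith

/-- The pathwise convergence estimate. -/
theorem IsFWPath.sum_fwGap_le {d T : ℕ} {X : Set (E d)} {η : ℝ} {w x y z v : ℕ → E d}
    (h : IsFWPath X T η w x y z) (hX : Convex ℝ X) (h0 : 0 < η) (h1 : η ≤ 2 / 3)
    {f : E d → ℝ} {L D Δ : ℝ} (hf : LSmoothOn L f X) (hL : 0 ≤ L)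
    (hD : ∀ a ∈ X, ∀ b ∈ X, ‖a - b‖ ≤ D) (hΔ : ∀ a ∈ X, ∀ b ∈ X, f a - f b ≤ Δ)
    (hmax : ∀ t < T, IsMaxOn (fun q => inner ℝ q (-v t)) X (w t)) :
    ∑ t ∈ Finset.range T, fwGap X f (z t) ≤ Δ / η +
      2 * D * ∑ t ∈ Finset.range T, ‖v t - gradient f (z t)‖ +
      2 * (Δ + L * D ^ 2) * ∑ t ∈ Finset.range T, parα (t + 1) + T * η * (9 * L * D ^ 2) := by
  have hsum : ∑ t ∈ Finset.range T, η * fwGap X f (z t) ≤ ∑ t ∈ Finset.range T,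
      (f (z t) - f (z (t + 1)) + η * (2 * D * ‖v t - gradient f (z t)‖) +
      η * (2 * (Δ + L * D ^ 2) * parα (t + 1)) + η ^ 2 * (9 * L * D ^ 2)) :=
    Finset.sum_le_sum fun t ht => h.mul_fwGap_le hX h0.le h1 hf hL hD hΔ
      (Finset.mem_range.1 ht) (hmax t (Finset.mem_range.1 ht))
  simp only [Finset.sum_add_distrib, ← Finset.mul_sum, Finset.sum_range_sub',
    Finset.sum_const, Finset.card_range, nsmul_eq_mul] at hsum
  have hΔ' := hΔ _ (h.iterates_mem hX h0.le h1 0 (Nat.zero_le _)).2.2 _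
    (h.iterates_mem hX h0.le h1 T le_rfl).2.2
  refine le_of_mul_le_mul_left ?_ h0
  refine hsum.trans ?_
  have : η * (Δ / η) = Δ := by field_simp
  linear_combination hΔ' - this

end FrankWolfe

/-! ### One step of the variance-reduced momentum estimator. -/

section Momentum

open Set Filter

variable {V : Type*} [NormedAddCommGroup V] {Q : Type*} [MeasurableSpace Q] {ν : Measure Q}

theorem lintegral_enorm_sq_eq_ofReal {f : Q → V} (hf : MemLp f 2 ν) :
    ∫⁻ q, ‖f q‖ₑ ^ 2 ∂ν = ENNReal.ofReal (∫ q, ‖f q‖ ^ 2 ∂ν) := by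
  rw [ofReal_integral_eq_lintegral_ofReal hf.norm.integrable_sq
    (Eventually.of_forall fun q => by positivity)]
  refine lintegral_congr fun q => ?_
  rw [← ofReal_norm, ← ENNReal.ofReal_pow (norm_nonneg _)]

theorem integral_norm_sq_le_of_lintegral {f : Q → V} {C : ℝ} (hC : 0 ≤ C) (hf : MemLp f 2 ν)
    (h : ∫⁻ q, ‖f q‖ₑ ^ 2 ∂ν ≤ ENNReal.ofReal C) : ∫ q, ‖f q‖ ^ 2 ∂ν ≤ C := by
  rw [lintegral_enorm_sq_eq_ofReal hf] at h
  exact (ENNReal.ofReal_le_ofReal_iff hC).1 h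

theorem integral_norm_le_sqrt_of_lintegral [IsProbabilityMeasure ν] {f : Q → V} {C : ℝ}
    (hC : 0 ≤ C) (hf : MemLp f 2 ν) (h : ∫⁻ q, ‖f q‖ₑ ^ 2 ∂ν ≤ ENNReal.ofReal C) :
    ∫ q, ‖f q‖ ∂ν ≤ √C := by
  have h1 := integral_norm_sq_le_of_lintegral hC hf h
  refine Real.le_sqrt_of_sq_le (le_trans ?_ h1)
  set m := ∫ q, ‖f q‖ ∂ν with hm
  have hi : Integrable (fun q => ‖f q‖) ν := hf.norm.integrable (by norm_num)
  have h2 : 0 ≤ ∫ q, (‖f q‖ - m) ^ 2 ∂ν := integral_nonneg fun q => sq_nonneg _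
  have h3 : ∫ q, (‖f q‖ - m) ^ 2 ∂ν = (∫ q, ‖f q‖ ^ 2 ∂ν) - m ^ 2 := by
    have : ∀ q, (‖f q‖ - m) ^ 2 = ‖f q‖ ^ 2 - 2 * m * ‖f q‖ + m ^ 2 := fun q => by ring
    simp only [this]
    have hi1 : Integrable (fun q => ‖f q‖ ^ 2) ν := hf.norm.integrable_sq
    have hi2 : Integrable (fun q => 2 * m * ‖f q‖) ν := hi.const_mul _
    have hi3 : Integrable (fun q => ‖f q‖ ^ 2 - 2 * m * ‖f q‖) ν := hi1.sub hi2
    rw [integral_add hi3 (integrable_const _), integral_sub hi1 hi2, integral_const_mul, ← hm]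
    simp only [integral_const, probReal_univ, one_smul]
    ring
  linarith

variable [InnerProductSpace ℝ V] [CompleteSpace V]

theorem integral_norm_const_add_sq [IsProbabilityMeasure ν] {N : Q → V} (hN : MemLp N 2 ν)
    (h0 : ∫ q, N q ∂ν = 0) (m : V) :
    ∫ q, ‖m + N q‖ ^ 2 ∂ν = ‖m‖ ^ 2 + ∫ q, ‖N q‖ ^ 2 ∂ν := by
  have hi : Integrable N ν := hN.integrable (by norm_num)
  have hin : Integrable (fun q => 2 * inner ℝ m (N q)) ν := (hi.const_inner m).const_mul 2
  simp only [norm_add_sq_real]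
  have hin' : Integrable (fun q => ‖m‖ ^ 2 + 2 * inner ℝ m (N q)) ν := (integrable_const _).add hin
  rw [integral_add hin' hN.norm.integrable_sq,
    integral_add (integrable_const _) hin, integral_const_mul, integral_inner hi, h0]
  simp

theorem integral_norm_sub_mean_sq_le [IsProbabilityMeasure ν] {Y : Q → V} (hY : MemLp Y 2 ν) :
    ∫ q, ‖Y q - ∫ q, Y q ∂ν‖ ^ 2 ∂ν ≤ ∫ q, ‖Y q‖ ^ 2 ∂ν := by
  have hi : Integrable Y ν := hY.integrable (by norm_num)
  have h := integral_norm_const_add_sq (hY.sub (memLp_const (∫ q, Y q ∂ν)))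
    (by simp [integral_sub hi (integrable_const _)]) (∫ q, Y q ∂ν)
  simp only [Pi.sub_apply, add_sub_cancel] at h
  rw [h]
  have : 0 ≤ ‖∫ q, Y q ∂ν‖ ^ 2 := by positivity
  linarith

/-- One step of a variance reduced momentum estimator, conditionally on the past. -/
theorem lintegral_momentum_le [IsProbabilityMeasure ν] {A B : Q → V} (hA : MemLp A 2 ν)
    (hB : MemLp B 2 ν) {s W c : ℝ} (hs : 0 ≤ s) (hW : 0 ≤ W) (hc0 : 0 ≤ c) (hc1 : c ≤ 1)
    (hvar : ∫⁻ q, ‖B q - ∫ q, B q ∂ν‖ₑ ^ 2 ∂ν ≤ ENNReal.ofReal s)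
    (hdiff : ∫⁻ q, ‖B q - A q‖ₑ ^ 2 ∂ν ≤ ENNReal.ofReal W) (m : V) :
    ∫⁻ q, ‖B q + c • (m - A q) - ∫ q, B q ∂ν‖ₑ ^ 2 ∂ν ≤
      ENNReal.ofReal (c ^ 2) * ‖m - ∫ q, A q ∂ν‖ₑ ^ 2 +
        ENNReal.ofReal (2 * (1 - c) ^ 2 * s + 2 * W) := by
  have hAi : Integrable A ν := hA.integrable (by norm_num)
  have hBi : Integrable B ν := hB.integrable (by norm_num)
  set a := ∫ q, A q ∂ν with ha
  set b := ∫ q, B q ∂ν with hb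
  have hY : MemLp (fun q => B q - A q) 2 ν := hB.sub hA
  have hYm : ∫ q, (B q - A q) ∂ν = b - a := integral_sub hBi hAi
  have hY1 : MemLp (fun q => (B q - A q) - (b - a)) 2 ν := hY.sub (memLp_const _)
  have hB1 : MemLp (fun q => B q - b) 2 ν := hB.sub (memLp_const _)
  have hN : MemLp (fun q => (1 - c) • (B q - b) + c • ((B q - A q) - (b - a))) 2 ν :=
    (hB1.const_smul (1 - c)).add (hY1.const_smul c)
  have hN0 : ∫ q, ((1 - c) • (B q - b) + c • ((B q - A q) - (b - a))) ∂ν = 0 := by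
    have hi1 : Integrable (fun q => (1 - c) • (B q - b)) ν :=
      (hB1.integrable (by norm_num)).smul (1 - c)
    have hi2 : Integrable (fun q => c • ((B q - A q) - (b - a))) ν :=
      (hY1.integrable (by norm_num)).smul c
    have hYi : Integrable (fun q => B q - A q) ν := hBi.sub hAi
    rw [integral_add hi1 hi2, integral_smul, integral_smul,
      integral_sub hBi (integrable_const _), integral_sub hYi (integrable_const _), hYm]
    simp [hb]
  -- The new error is the contracted old error c (m - a) plus centred noise, so the cross term
  -- vanishes in mean square. Within the noise, the variance of B is weighted by 1 - c, which is ρ,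
  -- and the rest sees only the difference B - A.
  have hrw : ∀ q, B q + c • (m - A q) - b =
      c • (m - a) + ((1 - c) • (B q - b) + c • ((B q - A q) - (b - a))) := by
    intro q
    module
  have hvar' := integral_norm_sq_le_of_lintegral hs hB1 hvar
  have hdiff' := integral_norm_sq_le_of_lintegral hW hY hdiff
  have hmean := integral_norm_sub_mean_sq_le hY
  rw [hYm] at hmean
  have hNle : ∫ q, ‖(1 - c) • (B q - b) + c • ((B q - A q) - (b - a))‖ ^ 2 ∂ν ≤
      2 * (1 - c) ^ 2 * s + 2 * W := by
    have hpt : ∀ q, ‖(1 - c) • (B q - b) + c • ((B q - A q) - (b - a))‖ ^ 2 ≤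
        2 * (1 - c) ^ 2 * ‖B q - b‖ ^ 2 + 2 * ‖(B q - A q) - (b - a)‖ ^ 2 := by
      intro q
      have h1 := norm_add_le ((1 - c) • (B q - b)) (c • ((B q - A q) - (b - a)))
      rw [norm_smul, norm_smul, Real.norm_of_nonneg hc0, Real.norm_of_nonneg (sub_nonneg.2 hc1)]
        at h1
      have h2 : c * ‖(B q - A q) - (b - a)‖ ≤ ‖(B q - A q) - (b - a)‖ :=
        mul_le_of_le_one_left (norm_nonneg _) hc1
      have h3 := h1.trans (add_le_add_right h2 _)
      have h4 := pow_le_pow_left₀ (norm_nonneg _) h3 2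
      nlinarith [sq_nonneg ((1 - c) * ‖B q - b‖ - ‖(B q - A q) - (b - a)‖)]
    have hi1 := hB1.norm.integrable_sq.const_mul (2 * (1 - c) ^ 2)
    have hi2 := hY1.norm.integrable_sq.const_mul 2
    calc _ ≤ ∫ q, (2 * (1 - c) ^ 2 * ‖B q - b‖ ^ 2 + 2 * ‖(B q - A q) - (b - a)‖ ^ 2) ∂ν :=
          integral_mono hN.norm.integrable_sq (hi1.add hi2) hpt
      _ = 2 * (1 - c) ^ 2 * ∫ q, ‖B q - b‖ ^ 2 ∂ν +
            2 * ∫ q, ‖(B q - A q) - (b - a)‖ ^ 2 ∂ν := by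
          rw [integral_add hi1 hi2, integral_const_mul, integral_const_mul]
      _ ≤ _ := by
          have := hmean.trans hdiff'
          gcongr
  have hall : MemLp (fun q => c • (m - a) +
      ((1 - c) • (B q - b) + c • ((B q - A q) - (b - a)))) 2 ν :=
    (memLp_const (c • (m - a))).add hN
  simp only [hrw]
  have hNi : 0 ≤ ∫ q, ‖(1 - c) • (B q - b) + c • ((B q - A q) - (b - a))‖ ^ 2 ∂ν :=
    integral_nonneg fun q => by positivity
  have hma : ENNReal.ofReal (‖c • (m - a)‖ ^ 2) = ENNReal.ofReal (c ^ 2) * ‖m - a‖ₑ ^ 2 := by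
    rw [norm_smul, mul_pow, ENNReal.ofReal_mul (by positivity), Real.norm_eq_abs, sq_abs,
      ENNReal.ofReal_pow (norm_nonneg _), ofReal_norm]
  rw [lintegral_enorm_sq_eq_ofReal hall, integral_norm_const_add_sq hN hN0, ← hma,
    ← ENNReal.ofReal_add (by positivity) (by positivity)]
  exact ENNReal.ofReal_le_ofReal (by gcongr)

/-- Integrating out a sample that is independent of the past. -/
theorem lintegral_comp_of_indep {Ω A : Type*} {m mΩ : MeasurableSpace Ω} [MeasurableSpace A]
    {P : Measure Ω} [IsProbabilityMeasure P] (hm : m ≤ mΩ) {Y : Ω → A} (hY : Measurable[m] Y)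
    {p : Ω → Q} (hp : Measurable p) (hlaw : P.map p = ν)
    (hind : Indep (MeasurableSpace.comap p inferInstance) m P) {Ψ : A × Q → ENNReal}
    (hΨ : Measurable Ψ) :
    ∫⁻ ω, Ψ (Y ω, p ω) ∂P = ∫⁻ ω, ∫⁻ q, Ψ (Y ω, q) ∂ν ∂P := by
  have hYm : Measurable Y := hY.mono hm le_rfl
  have hI : IndepFun Y p P := by
    rw [IndepFun_iff_Indep]
    exact (indep_of_indep_of_le_right hind hY.comap_le).symm
  have : IsProbabilityMeasure ν := hlaw ▸ Measure.isProbabilityMeasure_map hp.aemeasurable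
  have hmap := (indepFun_iff_map_prod_eq_prod_map_map hYm.aemeasurable hp.aemeasurable).1 hI
  rw [hlaw] at hmap
  have h1 : ∫⁻ ω, Ψ (Y ω, p ω) ∂P = ∫⁻ r, Ψ r ∂(P.map fun ω => (Y ω, p ω)) :=
    (lintegral_map hΨ (hYm.prodMk hp)).symm
  rw [h1, hmap, lintegral_prod _ hΨ.aemeasurable, lintegral_map hΨ.lintegral_prod_right' hYm]

/-- One step of a variance reduced momentum estimator. -/
theorem lintegral_momentum_step_le [FiniteDimensional ℝ V] [MeasurableSpace V] [BorelSpace V]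
    {Ω : Type*} {𝓜 mΩ : MeasurableSpace Ω} {P : Measure Ω} [IsProbabilityMeasure P]
    (hm : 𝓜 ≤ mΩ) {g : V → Q → V} (hg : Measurable (Function.uncurry g))
    {h : V → V} (hh : Measurable h) {X : Set V} {s W c r : ℝ} (hs : 0 ≤ s) (hW : 0 ≤ W)
    (hc0 : 0 ≤ c) (hc1 : c ≤ 1) (hL2 : ∀ x ∈ X, MemLp (g x) 2 ν)
    (hmean : ∀ x ∈ X, ∫ q, g x q ∂ν = h x)
    (hvar : ∀ x ∈ X, ∫⁻ q, ‖g x q - h x‖ₑ ^ 2 ∂ν ≤ ENNReal.ofReal s)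
    (hdiff : ∀ x ∈ X, ∀ y ∈ X, ‖y - x‖ ≤ r →
      ∫⁻ q, ‖g y q - g x q‖ₑ ^ 2 ∂ν ≤ ENNReal.ofReal W)
    {p : Ω → Q} (hp : Measurable p) (hlaw : P.map p = ν)
    (hind : Indep (MeasurableSpace.comap p inferInstance) 𝓜 P)
    {v v' a b : Ω → V} (hv : Measurable[𝓜] v) (ha : Measurable[𝓜] a) (hb : Measurable[𝓜] b)
    (haX : ∀ ω, a ω ∈ X) (hbX : ∀ ω, b ω ∈ X) (hab : ∀ ω, ‖b ω - a ω‖ ≤ r)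
    (hv' : ∀ ω, v' ω = g (b ω) (p ω) + c • (v ω - g (a ω) (p ω))) :
    ∫⁻ ω, ‖v' ω - h (b ω)‖ₑ ^ 2 ∂P ≤
      ENNReal.ofReal (c ^ 2) * ∫⁻ ω, ‖v ω - h (a ω)‖ₑ ^ 2 ∂P +
        ENNReal.ofReal (2 * (1 - c) ^ 2 * s + 2 * W) := by
  have : IsProbabilityMeasure ν := hlaw ▸ Measure.isProbabilityMeasure_map hp.aemeasurable
  set Ψ : (V × V × V) × Q → ENNReal := fun k =>
    ‖g k.1.2.2 k.2 + c • (k.1.1 - g k.1.2.1 k.2) - h k.1.2.2‖ₑ ^ 2 with hΨdef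
  have hΨ : Measurable Ψ := by
    have h1 : Measurable fun k : (V × V × V) × Q => g k.1.2.2 k.2 :=
      hg.comp (by fun_prop : Measurable fun k : (V × V × V) × Q => (k.1.2.2, k.2))
    have h2 : Measurable fun k : (V × V × V) × Q => g k.1.2.1 k.2 :=
      hg.comp (by fun_prop : Measurable fun k : (V × V × V) × Q => (k.1.2.1, k.2))
    fun_prop
  have hY : Measurable[𝓜] fun ω => (v ω, a ω, b ω) := hv.prodMk (ha.prodMk hb)
  -- The previous estimate and both points are determined by the past, so the fresh sample is
  -- averaged with them frozen.
  have key := lintegral_comp_of_indep hm hY hp hlaw hind hΨ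
  have hpt : ∀ ω, ∫⁻ q, Ψ ((v ω, a ω, b ω), q) ∂ν ≤
      ENNReal.ofReal (c ^ 2) * ‖v ω - h (a ω)‖ₑ ^ 2 +
        ENNReal.ofReal (2 * (1 - c) ^ 2 * s + 2 * W) := by
    intro ω
    have hmb := hmean _ (hbX ω)
    have := lintegral_momentum_le (hL2 _ (haX ω)) (hL2 _ (hbX ω)) hs hW hc0 hc1
      (by rw [hmb]; exact hvar _ (hbX ω)) (hdiff _ (haX ω) _ (hbX ω) (hab ω)) (v ω)
    rwa [hmb, hmean _ (haX ω)] at this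
  have hmeas : Measurable fun ω => ‖v ω - h (a ω)‖ₑ ^ 2 := by
    have hv1 := hv.mono hm le_rfl
    have ha1 := ha.mono hm le_rfl
    fun_prop
  calc ∫⁻ ω, ‖v' ω - h (b ω)‖ₑ ^ 2 ∂P = ∫⁻ ω, Ψ ((v ω, a ω, b ω), p ω) ∂P := by
        simp only [hv', hΨdef]
    _ = ∫⁻ ω, ∫⁻ q, Ψ ((v ω, a ω, b ω), q) ∂ν ∂P := key
    _ ≤ ∫⁻ ω, (ENNReal.ofReal (c ^ 2) * ‖v ω - h (a ω)‖ₑ ^ 2 +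
        ENNReal.ofReal (2 * (1 - c) ^ 2 * s + 2 * W)) ∂P := lintegral_mono hpt
    _ = _ := by
        rw [lintegral_add_right _ measurable_const, lintegral_const_mul _ hmeas]
        simp

end Momentum

/-! ### Scalar estimates with powers of exponent 1/3. -/

section CubeRoots

/-- The cube root of a natural number. -/
def cbrt (n : ℕ) : ℝ := (n : ℝ) ^ (1 / 3 : ℝ)

theorem cbrt_nonneg (n : ℕ) : 0 ≤ cbrt n := Real.rpow_nonneg n.cast_nonneg _

theorem cbrt_pow_three (n : ℕ) : cbrt n ^ 3 = n := by
  unfold cbrt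
  rw [← Real.rpow_natCast, ← Real.rpow_mul n.cast_nonneg]
  norm_num

theorem one_le_cbrt {n : ℕ} (hn : 1 ≤ n) : 1 ≤ cbrt n :=
  Real.one_le_rpow (by exact_mod_cast hn) (by norm_num)

theorem cbrt_pos {n : ℕ} (hn : 1 ≤ n) : 0 < cbrt n := zero_lt_one.trans_le (one_le_cbrt hn)

theorem cbrt_mono {m n : ℕ} (h : m ≤ n) : cbrt m ≤ cbrt n :=
  Real.rpow_le_rpow m.cast_nonneg (by exact_mod_cast h) (by norm_num)

theorem rpow_neg_two_thirds (n : ℕ) : (n : ℝ) ^ (-(2 / 3) : ℝ) = (cbrt n ^ 2)⁻¹ := by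
  unfold cbrt
  rw [Real.rpow_neg n.cast_nonneg, ← Real.rpow_natCast, ← Real.rpow_mul n.cast_nonneg]
  norm_num

theorem parρ_eq (t : ℕ) : parρ t = (cbrt t ^ 2)⁻¹ := rpow_neg_two_thirds t

theorem parη_eq (T t : ℕ) : parη T t = (cbrt T ^ 2)⁻¹ := rpow_neg_two_thirds T

theorem cbrt_le_cast {n : ℕ} (hn : 1 ≤ n) : cbrt n ≤ n := by
  have h1 := one_le_cbrt hn
  calc cbrt n ≤ cbrt n ^ 3 := le_self_pow₀ h1 (by norm_num)
    _ = n := cbrt_pow_three n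

/-- Cubing reduces this to (3/2)³ = 27/8 ≤ T², which holds from T = 2 on and fails for T = 1. -/
theorem parη_le {T : ℕ} (hT : 2 ≤ T) (t : ℕ) : parη T t ≤ 2 / 3 := by
  have h0 := cbrt_pos (by lia : 1 ≤ T)
  have h3 := cbrt_pow_three T
  have hT' : (2 : ℝ) ≤ T := by exact_mod_cast hT
  rw [parη_eq, inv_le_comm₀ (by positivity) (by norm_num)]
  by_contra hcon
  push Not at hcon
  have h1 : (cbrt T ^ 2) ^ 3 < (((2 / 3 : ℝ))⁻¹) ^ 3 := by gcongr
  have h2 : (cbrt T ^ 2) ^ 3 = (T : ℝ) ^ 2 := by rw [← h3]; ring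
  rw [h2] at h1
  norm_num at h1
  nlinarith

/-- For consecutive cube roots a and b, a³ - b³ = 1; this yields the exact increment of n^{2/3} and
replaces calculus below. -/
theorem cbrt_succ_sq_sub (n : ℕ) :
    (cbrt (n + 1) ^ 2 - cbrt n ^ 2) *
      (cbrt (n + 1) ^ 2 + cbrt (n + 1) * cbrt n + cbrt n ^ 2) = cbrt (n + 1) + cbrt n := by
  have h : cbrt (n + 1) ^ 3 - cbrt n ^ 3 = 1 := by
    rw [cbrt_pow_three, cbrt_pow_three]
    push_cast
    ring
  linear_combination (cbrt (n + 1) + cbrt n) * h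

/-- A telescoping form of the integral comparison: the inductive step is 2(a² + ab + b²) ≤ 3a(a +
b), true for 0 ≤ b ≤ a. -/
theorem sum_inv_cbrt_le (T : ℕ) :
    ∑ t ∈ Finset.range T, (cbrt (t + 1))⁻¹ ≤ 3 / 2 * cbrt T ^ 2 := by
  induction T with
  | zero => simp; positivity
  | succ n ih =>
    rw [Finset.sum_range_succ]
    have ha := cbrt_pos (by lia : 1 ≤ n + 1)
    have hb := cbrt_nonneg n
    have hab := cbrt_mono (Nat.le_succ n)
    have hd := cbrt_succ_sq_sub n
    set a := cbrt (n + 1)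
    set b := cbrt n
    suffices a⁻¹ ≤ 3 / 2 * (a ^ 2 - b ^ 2) by linarith
    have hs : 0 < a ^ 2 + a * b + b ^ 2 := by positivity
    have h1 : a ^ 2 - b ^ 2 = (a + b) / (a ^ 2 + a * b + b ^ 2) := by
      rw [eq_div_iff hs.ne', hd]
    rw [h1, inv_eq_one_div, ← mul_div_assoc, div_le_div_iff₀ ha hs]
    nlinarith

/-- The scalar recursion behind the decay of the momentum error. -/
theorem momentum_recursion (n : ℕ) {B : ℝ} (hB : 0 ≤ B) :
    (1 - parρ (n + 1)) ^ 2 * (3 * B / cbrt (n + 1) ^ 2) + B * parρ (n + 1) ^ 2 ≤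
      3 * B / cbrt (n + 2) ^ 2 := by
  rw [parρ_eq]
  have hb := one_le_cbrt (by lia : 1 ≤ n + 1)
  have hab : cbrt (n + 1) ≤ cbrt (n + 2) := cbrt_mono (by lia)
  have hd := cbrt_succ_sq_sub (n + 1)
  rw [show n + 1 + 1 = n + 2 by ring] at hd
  set a := cbrt (n + 2)
  set b := cbrt (n + 1)
  have hb0 : 0 < b := by linarith
  have ha0 : 0 < a := by linarith
  have hs : 0 < a ^ 2 + a * b + b ^ 2 := by positivity
  -- After (1 - ρ)² ≤ 1 - ρ with ρ = 1/b², the claim becomes (3b² - 2) a² ≤ 3b⁴, which is this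
  -- inequality rearranged.
  have h1 : 3 * b ^ 2 * (a ^ 2 - b ^ 2) ≤ 2 * a ^ 2 := by
    have h2 : a ^ 2 - b ^ 2 = (a + b) / (a ^ 2 + a * b + b ^ 2) := by
      rw [eq_div_iff hs.ne', hd]
    rw [h2, ← mul_div_assoc, div_le_iff₀ hs]
    have ha1 : 1 ≤ a := by linarith
    have h3 : a + b ≤ a * (a + b) := le_mul_of_one_le_left (by positivity) ha1
    have h4 : b ^ 2 ≤ a ^ 2 := by gcongr
    have h5 : 2 * b ^ 2 * (a + b) ≤ 2 * a ^ 2 * (a * (a + b)) := by gcongr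
    have h6 : b ^ 2 * (a + b) ≤ b ^ 2 * (2 * a ^ 2) := by
      gcongr
      nlinarith
    nlinarith
  have hr0 : 0 < (b ^ 2)⁻¹ := by positivity
  have hr1 : (b ^ 2)⁻¹ ≤ 1 := inv_le_one_of_one_le₀ (one_le_pow₀ hb)
  have h7 : (1 - (b ^ 2)⁻¹) ^ 2 ≤ 1 - (b ^ 2)⁻¹ := by nlinarith
  calc _ ≤ (1 - (b ^ 2)⁻¹) * (3 * B / b ^ 2) + B * (b ^ 2)⁻¹ ^ 2 := by gcongr
    _ = B * (3 * b ^ 2 - 2) / b ^ 4 := by field_simp; ring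
    _ ≤ 3 * B / a ^ 2 := by
      rw [div_le_div_iff₀ (by positivity) (by positivity)]
      have : (3 * b ^ 2 - 2) * a ^ 2 ≤ 3 * b ^ 4 := by nlinarith
      nlinarith

/-- Deliberately crude: the sum of the α_{t+1} is then O(T^{2/3}), the order of the main terms, so
no logarithm has to be carried along. -/
theorem parα_succ_le (t : ℕ) : parα (t + 1) ≤ (cbrt (t + 1))⁻¹ := by
  unfold parα
  rw [inv_eq_one_div]
  refine one_div_le_one_div_of_le (cbrt_pos (by lia)) ?_
  have := cbrt_le_cast (by lia : 1 ≤ t + 1)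
  linarith

end CubeRoots

/-! ### Measurability along a run. -/

section Run

open Set Filter

/-- A function continuous on a compact set agrees on it with a measurable function. -/
theorem exists_measurable_eqOn {A B : Type*} [TopologicalSpace A] [T2Space A] [MeasurableSpace A]
    [BorelSpace A] [TopologicalSpace B] [MeasurableSpace B] [BorelSpace B] [Zero B] {X : Set A}
    (hX : IsCompact X) {f : A → B} (hf : ContinuousOn f X) :
    ∃ g : A → B, Measurable g ∧ EqOn g f X := by
  classical
  exact ⟨X.piecewise f (fun _ => 0), hf.measurable_piecewise continuousOn_const hX.measurableSet,
    X.piecewise_eqOn _ _⟩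

theorem continuousOn_fwGap {d : ℕ} {X : Set (E d)} {f : E d → ℝ} {L : ℝ} (hL : 0 ≤ L)
    (hX : IsCompact X) (hf : LSmoothOn L f X) : ContinuousOn (fwGap X f) X := by
  rw [continuousOn_iff_continuous_domRestrict]
  have hg := continuousOn_iff_continuous_domRestrict.1 (hf.continuousOn_gradient hL)
  refine hX.continuous_sSup (f := fun (x : X) (w : E d) => inner ℝ (w - x) (-gradient f x)) ?_
  have h1 : Continuous fun k : X × E d => X.domRestrict (gradient f) k.1 := hg.comp continuous_fst
  have h2 : Continuous fun k : X × E d =>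
      inner ℝ (k.2 - (k.1 : E d)) (-X.domRestrict (gradient f) k.1) := by
    fun_prop
  exact h2

theorem Assumptions.objective_sub_le {d : ℕ} {S : Type*} [MeasurableSpace S] {μ : Measure S}
    [IsProbabilityMeasure μ] {F : E d → S → ℝ} {X : Set (E d)} {β L D σ Δ : ℝ}
    (h : Assumptions μ F X β L D σ Δ) (hL : 0 ≤ L) {a b : E d} (ha : a ∈ X) (hb : b ∈ X) :
    objective μ F a - objective μ F b ≤ Δ := by
  have hbdd : BddBelow (objective μ F '' X) :=
    (h.compact.image_of_continuousOn (h.lsmoothOn_objective_feasible hL).continuousOn).bddBelow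
  have := csInf_le hbdd ⟨b, hb, rfl⟩
  linarith [h.bounded a ha]

namespace IsRun

variable {d : ℕ} {S Ω : Type*} [MeasurableSpace S] [mΩ : MeasurableSpace Ω] {μ : Measure S}
  {F : E d → S → ℝ} {X : Set (E d)} {T : ℕ} {β : ℝ} {P : Measure Ω}
  {ℱ : Filtration ℕ (inferInstance : MeasurableSpace Ω)} {ξ : ℕ → Ω → S}
  {u : ℕ → Ω → Metric.sphere (0 : E d) 1} {v w x y z : ℕ → Ω → E d} {ζ : Ω → ℕ}

theorem isFWPath (h : IsRun μ F X T (parη T) (parγ T) parα parρ β P ℱ ξ u v w x y z ζ) (ω : Ω) :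
    IsFWPath X T (parη T 0) (fun t => w t ω) (fun t => x t ω) (fun t => y t ω)
      (fun t => z t ω) := by
  obtain ⟨x₀, hx₀, hi⟩ := h.init
  exact ⟨⟨x₀, hx₀, hi ω⟩, fun t ht => h.argmax_mem t ht ω, fun t ht => h.step_x t ht ω,
    fun t ht => h.step_y t ht ω, fun t ht => h.step_z t ht ω⟩

theorem grad_zero {η γ α ρ : ℕ → ℝ} (h : IsRun μ F X T η γ α ρ β P ℱ ξ u v w x y z ζ)
    (hT : 0 < T) (ω : Ω) : v 0 ω = uniGE β (fun q => F q (ξ 0 ω)) (u 0 ω : E d) (z 0 ω) :=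
  h.grad 0 hT ω

theorem grad_succ {η γ α ρ : ℕ → ℝ} (h : IsRun μ F X T η γ α ρ β P ℱ ξ u v w x y z ζ)
    {t : ℕ} (ht : t + 1 < T) (ω : Ω) :
    v (t + 1) ω = uniGE β (fun q => F q (ξ (t + 1) ω)) (u (t + 1) ω : E d) (z (t + 1) ω) +
      (1 - ρ (t + 1)) • (v t ω -
        uniGE β (fun q => F q (ξ (t + 1) ω)) (u (t + 1) ω : E d) (z t ω)) :=
  h.grad (t + 1) ht ω

/-- Iterates with index t are known at the end of iteration t - 1, hence before the sample of
iteration t is drawn. For t = 0 truncated subtraction gives `ℱ 0`, which is harmless since the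
starting point is deterministic. -/
theorem measurable_iterates {η γ α ρ : ℕ → ℝ}
    (h : IsRun μ F X T η γ α ρ β P ℱ ξ u v w x y z ζ) :
    ∀ t ≤ T, Measurable[ℱ (t - 1)] (x t) ∧ Measurable[ℱ (t - 1)] (y t) ∧
      Measurable[ℱ (t - 1)] (z t) := by
  intro t
  induction t with
  | zero =>
    intro _
    obtain ⟨x₀, -, hi⟩ := h.init
    rw [show x 0 = fun _ => x₀ from funext fun ω => (hi ω).1,
      show y 0 = fun _ => x₀ from funext fun ω => (hi ω).2.1,
      show z 0 = fun _ => x₀ from funext fun ω => (hi ω).2.2]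
    exact ⟨measurable_const, measurable_const, measurable_const⟩
  | succ t ih =>
    intro ht
    obtain ⟨hx, hy, hz⟩ := ih (by lia)
    have hle : ℱ (t - 1) ≤ ℱ t := ℱ.mono (Nat.sub_le t 1)
    have hx' : Measurable[ℱ t] (x t) := hx.mono hle le_rfl
    have hz' : Measurable[ℱ t] (z t) := hz.mono hle le_rfl
    have hw := h.argmax_measurable t ht
    have hxn : Measurable[ℱ t] (x (t + 1)) := by
      rw [show x (t + 1) = fun ω => x t ω + γ t • (w t ω - x t ω) from funext (h.step_x t ht)]
      exact hx'.add ((hw.sub hx').const_smul (γ t))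
    have hyn : Measurable[ℱ t] (y (t + 1)) := by
      rw [show y (t + 1) = fun ω => z t ω + η t • (w t ω - z t ω) from funext (h.step_y t ht)]
      exact hz'.add ((hw.sub hz').const_smul (η t))
    refine ⟨hxn, hyn, ?_⟩
    rw [show z (t + 1) = fun ω => (1 - α (t + 1)) • y (t + 1) ω + α (t + 1) • x (t + 1) ω from
      funext (h.step_z t ht)]
    exact (hyn.const_smul (1 - α (t + 1))).add (hxn.const_smul (α (t + 1)))

theorem measurable_z {η γ α ρ : ℕ → ℝ} (h : IsRun μ F X T η γ α ρ β P ℱ ξ u v w x y z ζ)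
    {t s : ℕ} (ht : t ≤ T) (hs : t - 1 ≤ s) : Measurable[ℱ s] (z t) :=
  (h.measurable_iterates t ht).2.2.mono (ℱ.mono hs) le_rfl

theorem measurable_estimate {η γ α ρ : ℕ → ℝ} (h : IsRun μ F X T η γ α ρ β P ℱ ξ u v w x y z ζ)
    (hF : Measurable (Function.uncurry F)) {s t : ℕ} (hs : s ≤ T) (hst : s - 1 ≤ t) (ht : t < T) :
    Measurable[ℱ t] fun ω => uniGE β (fun q => F q (ξ t ω)) (u t ω : E d) (z s ω) := by
  have h1 : Measurable[ℱ t] fun ω => (z s ω, ξ t ω, u t ω) :=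
    (h.measurable_z hs hst).prodMk (h.sample_measurable t ht)
  have h2 := (measurable_uniGE hF β).comp h1
  simp only [Function.comp_def] at h2
  exact h2

theorem measurable_v {η γ α ρ : ℕ → ℝ} (h : IsRun μ F X T η γ α ρ β P ℱ ξ u v w x y z ζ)
    (hF : Measurable (Function.uncurry F)) : ∀ t < T, Measurable[ℱ t] (v t) := by
  intro t
  induction t with
  | zero =>
    intro ht
    rw [show v 0 = _ from funext (h.grad_zero ht)]
    exact h.measurable_estimate hF (Nat.zero_le T) le_rfl ht
  | succ t ih =>
    intro ht
    have hv : Measurable[ℱ (t + 1)] (v t) := (ih (by lia)).mono (ℱ.mono t.le_succ) le_rfl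
    have h1 := h.measurable_estimate hF ht.le (by lia : t + 1 - 1 ≤ t + 1) ht
    have h2 := h.measurable_estimate hF (by lia : t ≤ T) (by lia : t - 1 ≤ t + 1) ht
    rw [show v (t + 1) = _ from funext (h.grad_succ ht)]
    exact h1.add ((hv.sub h2).const_smul (1 - ρ (t + 1)))

end IsRun

end Run

/-! ### Decay of the gradient error and the summed gap. -/

section Rate

open Set Filter

/-- The constant in the bound on the mean square error of the gradient estimates. -/
def momentumConst (L D σ : ℝ) : ℝ := 2 * σ ^ 2 + 36 * L ^ 2 * D ^ 2 + 16 * L ^ 2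

theorem momentumConst_nonneg (L D σ : ℝ) : 0 ≤ momentumConst L D σ := by
  unfold momentumConst; positivity

/-- The constant in the convergence rate. -/
def rateConst (L D σ Δ : ℝ) : ℝ :=
  Δ + 3 * D * √(3 * momentumConst L D σ) + 2 * D * L + 3 * (Δ + L * D ^ 2) + 9 * L * D ^ 2

theorem rateConst_nonneg {L D σ Δ : ℝ} (hL : 0 ≤ L) (hD : 0 ≤ D) (hΔ : 0 ≤ Δ) :
    0 ≤ rateConst L D σ Δ := by
  unfold rateConst; positivity

theorem parβ_eq (d T : ℕ) : parβ d T = (d : ℝ)⁻¹ * (cbrt T ^ 2)⁻¹ := by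
  rw [parβ, rpow_neg_two_thirds]

theorem parβ_pos {d T : ℕ} (hd : 1 ≤ d) (hT : 2 ≤ T) : 0 < parβ d T := by
  have := cbrt_pos (by lia : 1 ≤ T)
  rw [parβ_eq]
  positivity

theorem parρ_mem {t : ℕ} (ht : 1 ≤ t) : 0 ≤ parρ t ∧ parρ t ≤ 1 := by
  rw [parρ_eq]
  exact ⟨by positivity, inv_le_one_of_one_le₀ (one_le_pow₀ (one_le_cbrt ht))⟩

namespace IsRun

variable {d : ℕ} {S Ω : Type*} [MeasurableSpace S] [mΩ : MeasurableSpace Ω] {μ : Measure S}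
  {F : E d → S → ℝ} {X : Set (E d)} {T : ℕ} {L D σ Δ : ℝ}
  {P : Measure Ω}
  {ℱ : Filtration ℕ (inferInstance : MeasurableSpace Ω)} {ξ : ℕ → Ω → S}
  {u : ℕ → Ω → Metric.sphere (0 : E d) 1} {v w x y z : ℕ → Ω → E d} {ζ : Ω → ℕ}

theorem z_mem (h : IsRun μ F X T (parη T) (parγ T) parα parρ (parβ d T) P ℱ ξ u v w x y z ζ)
    (hA : Assumptions μ F X (parβ d T) L D σ Δ) (hT : 2 ≤ T) {t : ℕ} (ht : t ≤ T) (ω : Ω) :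
    z t ω ∈ X := by
  have hη0 : 0 ≤ parη T 0 := by
    rw [parη_eq]
    positivity
  exact ((h.isFWPath ω).iterates_mem hA.convex hη0 (parη_le hT 0) t ht).2.2

variable [IsProbabilityMeasure μ]

theorem measurable_gap
    (h : IsRun μ F X T (parη T) (parγ T) parα parρ (parβ d T) P ℱ ξ u v w x y z ζ)
    (hA : Assumptions μ F X (parβ d T) L D σ Δ) (hL : 0 ≤ L) (hT : 2 ≤ T) {t s : ℕ} (ht : t ≤ T)
    (hs : t - 1 ≤ s) : Measurable[ℱ s] fun ω => fwGap X (objective μ F) (z t ω) := by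
  obtain ⟨g, hg, hgX⟩ := exists_measurable_eqOn hA.compact
    (continuousOn_fwGap hL hA.compact (hA.lsmoothOn_objective_feasible hL))
  have : (fun ω => fwGap X (objective μ F) (z t ω)) = fun ω => g (z t ω) :=
    funext fun ω => (hgX (h.z_mem hA hT ht ω)).symm
  rw [this]
  exact hg.comp (h.measurable_z ht hs)

variable [IsProbabilityMeasure P]

/-- The mean square error of the momentum gradient estimates decays like `t ^ (-2/3)`. -/
theorem lintegral_error_le
    (h : IsRun μ F X T (parη T) (parγ T) parα parρ (parβ d T) P ℱ ξ u v w x y z ζ)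
    (hA : Assumptions μ F X (parβ d T) L D σ Δ) (hL : 0 ≤ L) (hd : 1 ≤ d) (hT : 2 ≤ T)
    {G : E d → E d} (hG : Measurable G)
    (hGX : EqOn G (gradient (ballSmoothing (parβ d T) (objective μ F))) X) :
    ∀ t < T, ∫⁻ ω, ‖v t ω - G (z t ω)‖ₑ ^ 2 ∂P ≤
      ENNReal.ofReal (3 * (momentumConst L D σ * d) / cbrt (t + 1) ^ 2) := by
  have hβ := parβ_pos hd hT
  have hη0 : 0 < parη T 0 := by
    have := cbrt_pos (by lia : 1 ≤ T)
    rw [parη_eq]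
    positivity
  have hη1 := parη_le hT 0
  have hd1 : (1 : ℝ) ≤ d := by exact_mod_cast hd
  have hB := momentumConst_nonneg L D σ
  have hp : ∀ t < T, Measurable fun ω => (ξ t ω, u t ω) := fun t ht =>
    (h.sample_measurable t ht).mono (ℱ.le t) le_rfl
  set g : E d → S × Metric.sphere (0 : E d) 1 → E d := fun q p =>
    uniGE (parβ d T) (fun y => F y p.1) (p.2 : E d) q with hg
  have hgm : Measurable (Function.uncurry g) := measurable_uniGE hA.measurable _
  have hvar : ∀ q ∈ X, ∫⁻ p, ‖g q p - G q‖ₑ ^ 2 ∂(μ.prod (uniformSphere d)) ≤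
      ENNReal.ofReal (σ ^ 2) := by
    intro q hq
    rw [hGX hq]
    exact hA.variance q hq
  have hzX : ∀ t ≤ T, ∀ ω, z t ω ∈ X := fun t ht ω => h.z_mem hA hT ht ω
  intro t
  induction t with
  | zero =>
    intro ht
    obtain ⟨x₀, hx₀, hi⟩ := h.init
    have hv : ∀ ω, v 0 ω - G (z 0 ω) = g x₀ (ξ 0 ω, u 0 ω) - G x₀ := by
      intro ω
      rw [h.grad_zero ht, (hi ω).2.2]
    have hgx : Measurable fun p => ‖g x₀ p - G x₀‖ₑ ^ 2 :=
      ((hA.measurable_estimator x₀).sub measurable_const).enorm.pow_const 2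
    simp only [hv]
    rw [← lintegral_map hgx (hp 0 ht), h.sample_law 0 ht]
    refine (hvar x₀ hx₀).trans (ENNReal.ofReal_le_ofReal ?_)
    have hc : cbrt (0 + 1) = 1 := by simp [cbrt]
    rw [hc, one_pow, div_one]
    have h1 : σ ^ 2 ≤ momentumConst L D σ := by
      unfold momentumConst
      have : 0 ≤ σ ^ 2 + 36 * L ^ 2 * D ^ 2 + 16 * L ^ 2 := by positivity
      linarith
    nlinarith
  | succ t ih =>
    intro ht
    have htT : t < T := by lia
    obtain ⟨hρ0, hρ1⟩ := parρ_mem (by lia : 1 ≤ t + 1)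
    have hηρ : parη T 0 ≤ parρ (t + 1) := by
      rw [parη_eq, parρ_eq]
      have h1 := cbrt_pos (by lia : 1 ≤ t + 1)
      have h2 := cbrt_mono ht.le
      gcongr
    -- The choice of β makes the finite-difference error L dβ equal to Lη, the scale of the movement
    -- of the iterates.
    have hdβ : (d : ℝ) * parβ d T = parη T 0 := by
      rw [parβ_eq, parη_eq]
      field_simp
    set W := 2 * d * (L * (3 * parη T 0 * D)) ^ 2 + 8 * (L * (d * parβ d T)) ^ 2 with hW
    have hdiff : ∀ a ∈ X, ∀ b ∈ X, ‖b - a‖ ≤ 3 * parη T 0 * D →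
        ∫⁻ p, ‖g b p - g a p‖ₑ ^ 2 ∂(μ.prod (uniformSphere d)) ≤ ENNReal.ofReal W := by
      intro a ha b hb hab
      refine (hA.lintegral_estimator_sub_le hd hL hβ ha hb).trans (ENNReal.ofReal_le_ofReal ?_)
      rw [hW]
      gcongr
    have hstep := lintegral_momentum_step_le (ℱ.le t) hgm hG (X := X) (s := σ ^ 2) (W := W)
      (c := 1 - parρ (t + 1)) (r := 3 * parη T 0 * D) (by positivity) (by positivity)
      (by linarith) (by linarith) (fun q hq => hA.memLp_estimator hd hq)
      (fun q hq => (hA.integral_estimator hd hL hβ hq).trans (hGX hq).symm) hvar hdiff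
      (hp (t + 1) ht) (h.sample_law (t + 1) ht) (h.sample_indep t ht)
      (h.measurable_v hA.measurable t htT) (h.measurable_z htT.le (Nat.sub_le t 1))
      (h.measurable_z ht.le le_rfl) (hzX t htT.le) (hzX (t + 1) ht.le)
      (fun ω => (h.isFWPath ω).norm_sub_succ_le hA.convex hη0.le hη1 hA.diam htT)
      (h.grad_succ ht)
    have hc := cbrt_pos (by lia : 1 ≤ t + 1)
    calc _ ≤ _ := hstep
      _ ≤ ENNReal.ofReal ((1 - parρ (t + 1)) ^ 2) *
            ENNReal.ofReal (3 * (momentumConst L D σ * d) / cbrt (t + 1) ^ 2) +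
          ENNReal.ofReal (2 * (1 - (1 - parρ (t + 1))) ^ 2 * σ ^ 2 + 2 * W) := by
        gcongr
        exact ih htT
      _ = ENNReal.ofReal ((1 - parρ (t + 1)) ^ 2 *
            (3 * (momentumConst L D σ * d) / cbrt (t + 1) ^ 2) +
          (2 * (1 - (1 - parρ (t + 1))) ^ 2 * σ ^ 2 + 2 * W)) := by
        rw [← ENNReal.ofReal_mul (by positivity), ← ENNReal.ofReal_add (by positivity)
          (by positivity)]
      _ ≤ _ := by
        refine ENNReal.ofReal_le_ofReal (le_trans ?_
          (momentum_recursion t (mul_nonneg hB (by linarith : (0 : ℝ) ≤ d))))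
        gcongr
        -- The noise is 2ρ²σ² + 36 d (LD)² η² + 16 (Lη)²; with η ≤ ρ and 1 ≤ d it is at most
        -- `momentumConst` times d ρ².
        rw [hW, hdβ, sub_sub_cancel, momentumConst]
        have h2 : (L * parη T 0) ^ 2 ≤ d * (L * parρ (t + 1)) ^ 2 := by
          calc (L * parη T 0) ^ 2 ≤ (L * parρ (t + 1)) ^ 2 := by gcongr
            _ ≤ _ := le_mul_of_one_le_left (by positivity) hd1
        have h3 : (d : ℝ) * (L * D) ^ 2 * parη T 0 ^ 2 ≤
            d * (L * D) ^ 2 * parρ (t + 1) ^ 2 := by gcongr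
        have h4 : parρ (t + 1) ^ 2 * σ ^ 2 ≤ d * (parρ (t + 1) ^ 2 * σ ^ 2) :=
          le_mul_of_one_le_left (by positivity) hd1
        linear_combination 36 * h3 + 16 * h2 + 2 * h4

theorem integrable_gap
    (h : IsRun μ F X T (parη T) (parγ T) parα parρ (parβ d T) P ℱ ξ u v w x y z ζ)
    (hA : Assumptions μ F X (parβ d T) L D σ Δ) (hL : 0 ≤ L) (hT : 2 ≤ T) {t : ℕ} (ht : t ≤ T) :
    Integrable (fun ω => fwGap X (objective μ F) (z t ω)) P := by
  refine Integrable.of_mem_Icc 0 (Δ + L * D ^ 2)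
    ((h.measurable_gap hA hL hT ht le_rfl).mono (ℱ.le _) le_rfl).aemeasurable
    (Eventually.of_forall fun ω => ?_)
  exact (hA.lsmoothOn_objective_feasible hL).fwGap_mem_Icc hL hA.convex hA.diam
    (fun a ha b hb => hA.objective_sub_le hL ha hb) (h.z_mem hA hT ht ω)

/-- The terms of order T^{2/3} are Δ/η, the sum of the α_{t+1} and the sum of the gradient errors,
and only the last carries √d. The smoothing bias and the curvature term are O(T^{1/3}). All are
relaxed to the common scale √d T^{2/3}. -/
theorem sum_integral_gap_le
    (h : IsRun μ F X T (parη T) (parγ T) parα parρ (parβ d T) P ℱ ξ u v w x y z ζ)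
    (hA : Assumptions μ F X (parβ d T) L D σ Δ) (hL : 0 ≤ L) (hD : 0 ≤ D) (hΔ : 0 ≤ Δ)
    (hd : 1 ≤ d) (hT : 2 ≤ T) :
    ∑ t ∈ Finset.range T, ∫ ω, fwGap X (objective μ F) (z t ω) ∂P ≤
      rateConst L D σ Δ * (√d * cbrt T ^ 2) := by
  have hβ := parβ_pos hd hT
  have hc := one_le_cbrt (by lia : 1 ≤ T)
  have hc0 : 0 < cbrt T := by linarith
  have hη0 : 0 < parη T 0 := by
    rw [parη_eq]
    positivity
  have hf := hA.lsmoothOn_objective_feasible hL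
  have hd1 : (1 : ℝ) ≤ d := by exact_mod_cast hd
  have hsd : 1 ≤ √(d : ℝ) := Real.one_le_sqrt.2 hd1
  have hB := momentumConst_nonneg L D σ
  -- The gradient of the smoothed objective is known to be continuous only on `X`. Since the z_t
  -- stay in `X`, a measurable function agreeing with it there suffices.
  obtain ⟨G, hG, hGX⟩ := exists_measurable_eqOn hA.compact
    ((hA.lsmoothOn_smoothed hL hβ.le).continuousOn_gradient hL)
  have herr := h.lintegral_error_le hA hL hd hT hG hGX
  have hL2 : ∀ t < T, MemLp (fun ω => v t ω - G (z t ω)) 2 P := by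
    intro t ht
    refine memLp_two_of_lintegral (Measurable.aestronglyMeasurable ?_)
      ((herr t ht).trans_lt ENNReal.ofReal_lt_top).ne
    have hv : Measurable (v t) := (h.measurable_v hA.measurable t ht).mono (ℱ.le t) le_rfl
    have hz : Measurable (z t) := (h.measurable_z ht.le le_rfl).mono (ℱ.le _) le_rfl
    exact hv.sub (hG.comp hz)
  have hint : ∀ t < T, Integrable (fun ω => ‖v t ω - G (z t ω)‖) P := fun t ht =>
    (hL2 t ht).norm.integrable (by norm_num)
  have hmean : ∀ t < T, ∫ ω, ‖v t ω - G (z t ω)‖ ∂P ≤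
      √(3 * momentumConst L D σ) * √d * (cbrt (t + 1))⁻¹ := by
    intro t ht
    refine (integral_norm_le_sqrt_of_lintegral (by positivity) (hL2 t ht) (herr t ht)).trans_eq ?_
    rw [Real.sqrt_div (by positivity), Real.sqrt_sq (cbrt_nonneg _), ← mul_assoc,
      Real.sqrt_mul (by positivity), div_eq_mul_inv]
  have hsα : ∑ t ∈ Finset.range T, parα (t + 1) ≤ 3 / 2 * cbrt T ^ 2 :=
    (Finset.sum_le_sum fun t _ => parα_succ_le t).trans (sum_inv_cbrt_le T)
  have hpath : ∀ ω, ∑ t ∈ Finset.range T, fwGap X (objective μ F) (z t ω) ≤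
      2 * D * ∑ t ∈ Finset.range T, ‖v t ω - G (z t ω)‖ +
      (Δ / parη T 0 + 2 * D * (T * (L * parβ d T)) +
        2 * (Δ + L * D ^ 2) * (3 / 2 * cbrt T ^ 2) + T * parη T 0 * (9 * L * D ^ 2)) := by
    intro ω
    have h1 := (h.isFWPath ω).sum_fwGap_le hA.convex hη0 (parη_le hT 0) hf hL hA.diam
      (fun a ha b hb => hA.objective_sub_le hL ha hb) (fun t ht => h.argmax t ht ω)
    have h2 : ∑ t ∈ Finset.range T, ‖v t ω - gradient (objective μ F) (z t ω)‖ ≤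
        ∑ t ∈ Finset.range T, ‖v t ω - G (z t ω)‖ + T * (L * parβ d T) := by
      calc _ ≤ ∑ t ∈ Finset.range T, (‖v t ω - G (z t ω)‖ + L * parβ d T) := by
            refine Finset.sum_le_sum fun t ht => ?_
            have hz := h.z_mem hA hT (Finset.mem_range.1 ht).le ω
            have h3 := hA.norm_gradient_smoothed_sub_le hL hβ.le hz
            rw [← hGX hz] at h3
            exact (norm_sub_le_norm_sub_add_norm_sub _ (G (z t ω)) _).trans
              (add_le_add_right h3 _)
        _ = _ := by simp [Finset.sum_add_distrib]
    have h4 : 2 * D * ∑ t ∈ Finset.range T, ‖v t ω - gradient (objective μ F) (z t ω)‖ ≤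
        2 * D * (∑ t ∈ Finset.range T, ‖v t ω - G (z t ω)‖ + T * (L * parβ d T)) := by gcongr
    have h5 : 2 * (Δ + L * D ^ 2) * ∑ t ∈ Finset.range T, parα (t + 1) ≤
        2 * (Δ + L * D ^ 2) * (3 / 2 * cbrt T ^ 2) := by gcongr
    linarith
  have hmono := integral_mono (μ := P)
    (integrable_finsetSum _ fun t ht => h.integrable_gap hA hL hT (Finset.mem_range.1 ht).le)
    (((integrable_finsetSum _ fun t ht => hint t (Finset.mem_range.1 ht)).const_mul
      (2 * D)).add (integrable_const _)) hpath
  rw [integral_finsetSum _ fun t ht => h.integrable_gap hA hL hT (Finset.mem_range.1 ht).le,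
    integral_add' ((integrable_finsetSum _ fun t ht => hint t (Finset.mem_range.1 ht)).const_mul
      (2 * D)) (integrable_const _), integral_const_mul,
    integral_finsetSum _ fun t ht => hint t (Finset.mem_range.1 ht)] at hmono
  simp only [integral_const, probReal_univ, one_smul] at hmono
  have hsum : ∑ t ∈ Finset.range T, ∫ ω, ‖v t ω - G (z t ω)‖ ∂P ≤
      √(3 * momentumConst L D σ) * √d * (3 / 2 * cbrt T ^ 2) := by
    calc _ ≤ ∑ t ∈ Finset.range T, √(3 * momentumConst L D σ) * √d * (cbrt (t + 1))⁻¹ :=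
          Finset.sum_le_sum fun t ht => hmean t (Finset.mem_range.1 ht)
      _ = √(3 * momentumConst L D σ) * √d * ∑ t ∈ Finset.range T, (cbrt (t + 1))⁻¹ :=
          (Finset.mul_sum _ _ _).symm
      _ ≤ _ := by
        gcongr
        exact sum_inv_cbrt_le T
  refine hmono.trans ?_
  have e1 : Δ / parη T 0 = Δ * cbrt T ^ 2 := by rw [parη_eq, div_inv_eq_mul]
  have e2 : (T : ℝ) * parη T 0 = cbrt T := by
    rw [parη_eq, ← cbrt_pow_three]
    field_simp
  have e3 : (T : ℝ) * (L * parβ d T) ≤ L * cbrt T := by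
    have : parβ d T ≤ parη T 0 := by
      rw [parβ_eq, parη_eq]
      exact mul_le_of_le_one_left (by positivity) (inv_le_one_of_one_le₀ hd1)
    calc (T : ℝ) * (L * parβ d T) ≤ T * (L * parη T 0) := by gcongr
      _ = L * (T * parη T 0) := by ring
      _ = L * cbrt T := by rw [e2]
  have hcc : cbrt T ≤ √d * cbrt T ^ 2 := by nlinarith
  have hcc2 : cbrt T ^ 2 ≤ √d * cbrt T ^ 2 := le_mul_of_one_le_left (by positivity) hsd
  rw [e1, e2]
  calc _ ≤ 2 * D * (√(3 * momentumConst L D σ) * √d * (3 / 2 * cbrt T ^ 2)) +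
        (Δ * cbrt T ^ 2 + 2 * D * (L * cbrt T) + 2 * (Δ + L * D ^ 2) * (3 / 2 * cbrt T ^ 2) +
          cbrt T * (9 * L * D ^ 2)) := by gcongr
    _ = 3 * D * √(3 * momentumConst L D σ) * (√d * cbrt T ^ 2) + Δ * cbrt T ^ 2 +
        2 * D * L * cbrt T + 3 * (Δ + L * D ^ 2) * cbrt T ^ 2 + 9 * L * D ^ 2 * cbrt T := by ring
    _ ≤ 3 * D * √(3 * momentumConst L D σ) * (√d * cbrt T ^ 2) + Δ * (√d * cbrt T ^ 2) +
        2 * D * L * (√d * cbrt T ^ 2) + 3 * (Δ + L * D ^ 2) * (√d * cbrt T ^ 2) +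
        9 * L * D ^ 2 * (√d * cbrt T ^ 2) := by gcongr
    _ = _ := by unfold rateConst; ring

end IsRun

end Rate

/-! ### The randomly chosen output and the number of queries. -/

section Output

open Set Filter

/-- Evaluating a process at an independent, uniformly distributed index. -/
theorem integral_uniform_index {Ω : Type*} {m mΩ : MeasurableSpace Ω} {P : Measure Ω}
    [IsProbabilityMeasure P] {T : ℕ} (hT : 0 < T) {ζ : Ω → ℕ}
    (hζ : Measurable ζ) (hunif : ∀ t < T, P {ω | ζ ω = t} = (T : ENNReal)⁻¹)
    (hind : Indep (MeasurableSpace.comap ζ inferInstance) m P) {Y : ℕ → Ω → ℝ}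
    (hY : ∀ t < T, Measurable[m] (Y t)) (hYi : ∀ t < T, Integrable (Y t) P) :
    Integrable (fun ω => Y (ζ ω) ω) P ∧
      ∫ ω, Y (ζ ω) ω ∂P = (1 / (T : ℝ)) * ∑ t ∈ Finset.range T, ∫ ω, Y t ω ∂P := by
  set c : ℕ → Ω → ℝ := fun t ω => if ζ ω = t then 1 else 0 with hc
  have hmeasS : ∀ t, MeasurableSet {ω | ζ ω = t} := fun t => hζ (measurableSet_singleton t)
  have hcm : ∀ t, Measurable (c t) := fun t =>
    Measurable.ite (hmeasS t) measurable_const measurable_const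
  have hcY : ∀ t < T, Integrable (fun ω => c t ω * Y t ω) P := by
    intro t ht
    refine (hYi t ht).bdd_mul (c := 1) (hcm t).aestronglyMeasurable
      (Eventually.of_forall fun ω => ?_)
    simp only [hc]
    split_ifs <;> simp
  -- The T masses 1/T exhaust the probability, so values of ζ outside the range are negligible.
  have hlt : ∀ᵐ ω ∂P, ζ ω < T := by
    have h1 : P (⋃ t ∈ Finset.range T, {ω | ζ ω = t}) = 1 := by
      rw [measure_biUnion_finset _ fun t _ => hmeasS t]
      · rw [Finset.sum_congr rfl fun t ht => hunif t (Finset.mem_range.1 ht)]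
        simp only [Finset.sum_const, Finset.card_range, nsmul_eq_mul]
        exact ENNReal.mul_inv_cancel (by exact_mod_cast hT.ne') (ENNReal.natCast_ne_top T)
      · intro s _ t _ hst
        refine disjoint_left.2 fun ω hs ht => hst ?_
        exact (show ζ ω = s from hs).symm.trans ht
    rw [← mem_ae_iff_prob_eq_one (Finset.measurableSet_biUnion _ fun t _ => hmeasS t)] at h1
    filter_upwards [h1] with ω hω
    simp only [mem_iUnion, Finset.mem_range] at hω
    obtain ⟨t, ht, hω⟩ := hω
    exact (show ζ ω = t from hω) ▸ ht
  have hae : (fun ω => ∑ t ∈ Finset.range T, c t ω * Y t ω) =ᵐ[P] fun ω => Y (ζ ω) ω := by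
    filter_upwards [hlt] with ω hω
    rw [Finset.sum_eq_single_of_mem (ζ ω) (Finset.mem_range.2 hω)]
    · simp [hc]
    · intro t _ ht
      simp [hc, Ne.symm ht]
  have hsum : Integrable (fun ω => ∑ t ∈ Finset.range T, c t ω * Y t ω) P :=
    integrable_finsetSum _ fun t ht => hcY t (Finset.mem_range.1 ht)
  refine ⟨hsum.congr hae, ?_⟩
  rw [← integral_congr_ae hae, integral_finsetSum _ fun t ht => hcY t (Finset.mem_range.1 ht),
    Finset.mul_sum]
  refine Finset.sum_congr rfl fun t ht => ?_
  have htT := Finset.mem_range.1 ht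
  have hI : IndepFun (c t) (Y t) P := by
    have h1 : IndepFun ζ (Y t) P := by
      rw [IndepFun_iff_Indep]
      exact indep_of_indep_of_le_right hind (hY t htT).comap_le
    exact h1.comp (φ := fun n : ℕ => if n = t then (1 : ℝ) else 0) (ψ := id)
      (measurable_of_countable _) measurable_id
  rw [hI.integral_fun_mul_eq_mul_integral (hcm t).aestronglyMeasurable
    (hYi t htT).aestronglyMeasurable]
  congr 1
  have : c t = {ω | ζ ω = t}.indicator 1 := by
    ext ω
    simp [hc, indicator_apply]
  rw [this, integral_indicator_one (hmeasS t), Measure.real, hunif t htT]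
  simp

/-- Two estimators with two function values each; for t = 0 there is only one estimator. -/
theorem gradStep_cost_le {d : ℕ} (β : ℝ) (ρ : ℕ → ℝ) (u : E d) (z v : ℕ → E d) (t : ℕ)
    (g : E d → ℝ) : (gradStep β ρ u z v t).cost g ≤ 4 := by
  cases t <;> simp [gradStep, uniGEProg, QueryProg.bind, QueryProg.cost]

theorem queries_le {d : ℕ} {S Ω : Type*} (F : E d → S → ℝ) (T : ℕ) (ρ : ℕ → ℝ) (β : ℝ)
    (ξ : ℕ → Ω → S) (u : ℕ → Ω → Metric.sphere (0 : E d) 1) (v z : ℕ → Ω → E d) (ω : Ω) :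
    queries F T ρ β ξ u v z ω ≤ 4 * T := by
  calc _ ≤ ∑ _t ∈ Finset.range T, 4 :=
        Finset.sum_le_sum fun t _ => gradStep_cost_le _ _ _ _ _ _ _
    _ = 4 * T := by simp [mul_comm]

/-- The convergence rate of the output of a run. -/
theorem gap_bound_of_isRun {L D σ Δ : ℝ} (hL : 0 ≤ L) (hD : 0 ≤ D) (hΔ : 0 ≤ Δ)
    {d T : ℕ} (hd : 1 ≤ d) (hT : 2 ≤ T) {S : Type*} [MeasurableSpace S] {μ : Measure S}
    [IsProbabilityMeasure μ] {F : E d → S → ℝ} {X : Set (E d)}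
    (hA : Assumptions μ F X (parβ d T) L D σ Δ) {Ω : Type*} [MeasurableSpace Ω] {P : Measure Ω}
    [IsProbabilityMeasure P] {ℱ : Filtration ℕ (inferInstance : MeasurableSpace Ω)}
    {ξ : ℕ → Ω → S} {u : ℕ → Ω → Metric.sphere (0 : E d) 1}
    {v w x y z : ℕ → Ω → E d} {ζ : Ω → ℕ}
    (h : IsRun μ F X T (parη T) (parγ T) parα parρ (parβ d T) P ℱ ξ u v w x y z ζ) :
    (∀ t < T, Integrable (fun ω => fwGap X (objective μ F) (z t ω)) P) ∧
      Integrable (fun ω => fwGap X (objective μ F) (z (ζ ω) ω)) P ∧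
      ∫ ω, fwGap X (objective μ F) (z (ζ ω) ω) ∂P =
        (1 / (T : ℝ)) * ∑ t ∈ Finset.range T, ∫ ω, fwGap X (objective μ F) (z t ω) ∂P ∧
      (1 / (T : ℝ)) * ∑ t ∈ Finset.range T, ∫ ω, fwGap X (objective μ F) (z t ω) ∂P ≤
        rateConst L D σ Δ * (√(d : ℝ) / (T : ℝ) ^ (1 / 3 : ℝ)) := by
  have hint : ∀ t < T, Integrable (fun ω => fwGap X (objective μ F) (z t ω)) P :=
    fun t ht => h.integrable_gap hA hL hT ht.le
  obtain ⟨h1, h2⟩ := integral_uniform_index (by lia : 0 < T) h.index_measurable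
    h.index_uniform h.index_indep
    (Y := fun t ω => fwGap X (objective μ F) (z t ω))
    (fun t ht => h.measurable_gap hA hL hT ht.le (by lia)) hint
  refine ⟨hint, h1, h2, ?_⟩
  have hc := cbrt_pos (by lia : 1 ≤ T)
  calc _ ≤ 1 / (T : ℝ) * (rateConst L D σ Δ * (√d * cbrt T ^ 2)) := by
        gcongr
        exact h.sum_integral_gap_le hA hL hD hΔ hd hT
    _ = rateConst L D σ Δ * (√d / cbrt T) := by
        rw [← cbrt_pow_three]
        field_simp
    _ = _ := rfl

end Output

end ZerothOrderFW

end

/-! ### The convergence rate and the query complexity. -/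

open ZerothOrderFW in
theorem theorem5 (L D σ Δ : ℝ) (hL : 0 ≤ L) (hD : 0 ≤ D) (hσ : 0 ≤ σ) (hΔ : 0 ≤ Δ) :
    ∃ C₁ C₂ K M : ℝ,
      (∀ (d T : ℕ), 1 ≤ d → 2 ≤ T →
        ∀ (S : Type*) [MeasurableSpace S] (μ : Measure S) [IsProbabilityMeasure μ]
          (F : E d → S → ℝ) (X : Set (E d)),
        Assumptions μ F X (parβ d T) L D σ Δ →
        ∀ (Ω : Type*) [MeasurableSpace Ω] (P : Measure Ω) [IsProbabilityMeasure P]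
          (ℱ : Filtration ℕ (inferInstance : MeasurableSpace Ω))
          (ξ : ℕ → Ω → S) (u : ℕ → Ω → Metric.sphere (0 : E d) 1)
          (v w x y z : ℕ → Ω → E d) (ζ : Ω → ℕ),
        IsRun μ F X T (parη T) (parγ T) parα parρ (parβ d T) P ℱ ξ u v w x y z ζ →
          (∀ t < T, Integrable (fun ω => fwGap X (objective μ F) (z t ω)) P) ∧
          Integrable (fun ω => fwGap X (objective μ F) (z (ζ ω) ω)) P ∧
          ∫ ω, fwGap X (objective μ F) (z (ζ ω) ω) ∂P =
            (1 / (T : ℝ)) * ∑ t ∈ Finset.range T, ∫ ω, fwGap X (objective μ F) (z t ω) ∂P ∧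
          (1 / (T : ℝ)) * ∑ t ∈ Finset.range T, ∫ ω, fwGap X (objective μ F) (z t ω) ∂P ≤
            C₁ * (√(d : ℝ) / (T : ℝ) ^ (1 / 3 : ℝ)) +
              C₂ * (√(d : ℝ) * Real.log T / (T : ℝ) ^ (4 / 3 : ℝ))) ∧
      (∀ (d T : ℕ) (ε : ℝ), 1 ≤ d → 0 < ε → ε ≤ 1 →
        T = ⌈K * (d : ℝ) ^ (3 / 2 : ℝ) * ε ^ (-3 : ℝ)⌉₊ →
        2 ≤ T ∧
        ∀ (S : Type*) [MeasurableSpace S] (μ : Measure S) [IsProbabilityMeasure μ]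
          (F : E d → S → ℝ) (X : Set (E d)),
        Assumptions μ F X (parβ d T) L D σ Δ →
        ∀ (Ω : Type*) [MeasurableSpace Ω] (P : Measure Ω) [IsProbabilityMeasure P]
          (ℱ : Filtration ℕ (inferInstance : MeasurableSpace Ω))
          (ξ : ℕ → Ω → S) (u : ℕ → Ω → Metric.sphere (0 : E d) 1)
          (v w x y z : ℕ → Ω → E d) (ζ : Ω → ℕ),
        IsRun μ F X T (parη T) (parγ T) parα parρ (parβ d T) P ℱ ξ u v w x y z ζ →
          ∫ ω, fwGap X (objective μ F) (z (ζ ω) ω) ∂P ≤ ε ∧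
          ∀ ω, (queries F T parρ (parβ d T) ξ u v z ω : ℝ) ≤
            M * ((d : ℝ) ^ (3 / 2 : ℝ) * ε ^ (-3 : ℝ))) := by
  have hR := rateConst_nonneg (σ := σ) hL hD hΔ
  set R := rateConst L D σ Δ with hRdef
  -- The bound has no logarithmic term, so C₂ = 0. With N = (√d/ε)³ ≥ 1, the part R³ of K makes R √d
  -- / T^{1/3} ≤ ε and the 2 forces T ≥ 2. Finally 4T ≤ 4(KN + 1) ≤ 4(R³ + 3) N, where the 1 comes
  -- from the ceiling.
  refine ⟨R, 0, R ^ 3 + 2, 4 * (R ^ 3 + 3), ?_, ?_⟩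
  · intro d T hd hT S _ μ _ F X hA Ω _ P _ ℱ ξ u v w x y z ζ hrun
    obtain ⟨h1, h2, h3, h4⟩ := gap_bound_of_isRun hL hD hΔ hd hT hA hrun
    refine ⟨h1, h2, h3, ?_⟩
    rw [zero_mul, add_zero]
    exact h4
  · intro d T ε hd hε hε1 hT
    have hd1 : (1 : ℝ) ≤ d := by exact_mod_cast hd
    set N : ℝ := (d : ℝ) ^ (3 / 2 : ℝ) * ε ^ (-3 : ℝ) with hN
    have hN1 : 1 ≤ N := by
      have e1 : 1 ≤ (d : ℝ) ^ (3 / 2 : ℝ) := Real.one_le_rpow hd1 (by norm_num)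
      have e2 : 1 ≤ ε ^ (-3 : ℝ) := Real.one_le_rpow_of_pos_of_le_one_of_nonpos hε hε1 (by norm_num)
      nlinarith
    have hNcube : N = (√(d : ℝ) / ε) ^ 3 := by
      rw [hN, div_pow, Real.rpow_neg hε.le, Real.sqrt_eq_rpow,
        ← Real.rpow_natCast ((d : ℝ) ^ (1 / 2 : ℝ)), ← Real.rpow_mul (by positivity),
        ← Real.rpow_natCast ε]
      norm_num
      exact (div_eq_mul_inv _ _).symm
    rw [mul_assoc, ← hN] at hT
    have hTle : (R ^ 3 + 2) * N ≤ T := hT ▸ Nat.le_ceil _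
    have hTlt : (T : ℝ) < (R ^ 3 + 2) * N + 1 := hT ▸ Nat.ceil_lt_add_one (by positivity)
    have hR3 : 0 ≤ R ^ 3 := by positivity
    have hT2 : 2 ≤ T := by
      have : (2 : ℝ) ≤ T := by nlinarith
      exact_mod_cast this
    refine ⟨hT2, ?_⟩
    intro S _ μ _ F X hA Ω _ P _ ℱ ξ u v w x y z ζ hrun
    constructor
    · obtain ⟨-, -, h3, h4⟩ := gap_bound_of_isRun hL hD hΔ hd hT2 hA hrun
      rw [h3]
      refine h4.trans ?_
      have hc := cbrt_pos (by lia : 1 ≤ T)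
      change R * (√(d : ℝ) / cbrt T) ≤ ε
      rw [← mul_div_assoc, div_le_iff₀ hc, ← div_le_iff₀' hε, mul_div_assoc]
      refine le_of_pow_le_pow_left₀ (n := 3) (by norm_num) hc.le ?_
      rw [cbrt_pow_three, mul_pow, ← hNcube]
      nlinarith
    · intro ω
      have h1 : (queries F T parρ (parβ d T) ξ u v z ω : ℝ) ≤ 4 * T := by
        exact_mod_cast queries_le F T parρ (parβ d T) ξ u v z ω
      nlinarith
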